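/- Let $d\ge 1$ and let $X=(X_1,\dots,X_d)$ be a random vector in $\mathbb{R}^d$ with i.i.d. coordinates which is infinitely divisible without Gaussian component, i.e. for some $\gamma\in\mathbb{R}^d$ and some Borel measure $\nu\neq 0$ on $\mathbb{R}^d$ with $\nu(\{0\})=0$ and $\int(1\wedge\|u\|_2^2)\,\nu(du)<\infty$, $$\mathbb{E}e^{i\langle t,X\rangle}=\exp\Big\{i\langle t,\gamma\rangle+\int_{\mathbb{R}^d}\big(e^{i\langle t,u\rangle}-1-i\langle t,u\rangle\mathbf{1}_{\|u\|_2\le 1}\big)\nu(du)\Big\},\qquad t\in\mathbb{R}^d.$$ Let $\tilde\nu$ be the one-dimensional Lévy measure with $\nu=\sum_{k=1}^d \tilde\nu\circ(u\mapsto u e_k)^{-1}$, where $(e_k)$ is the canonical basis. Assume that $\mathbb{E}e^{t\|X\|_2}<+\infty$ for some $t>0$, and let $M=\sup\{t>0:\mathbb{E}e^{t|X_1|}<+\infty\}\in(0,+\infty]$. Let $2\le p<\infty$ and $\varepsilon>0$, let $\|x\|_p=(\sum_k|x_k|^p)^{1/p}$, and for $0\le t<M$ let $$h(t)=p^2\int_{\mathbb{R}}\left(1+\frac{|u|\,d^{1/(2p-2)}}{\varepsilon\,\mathbb{E}\|X\|_p}\right)^{2p-2}|u|\,(e^{t|u|}-1)\,\tilde\nu(du).$$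 Then $0<\mathbb{E}\|X\|_p<\infty$, the function $h$ is finite on $[0,M)$ and is a strictly increasing bijection from $[0,M)$ onto $[0,h(M^-))$, where $h(M^-)=\lim_{t\uparrow M}h(t)\in(0,+\infty]$; let $h^{-1}$ be its inverse. For all $0<x<h(M^-)$, the integral $\int_0^x h^{-1}(s)\,ds$ is finite, $$\mathbb{P}\big(\|X\|_p\ge(1+\varepsilon)\mathbb{E}\|X\|_p+x\big)\le e^{-\int_0^x h^{-1}(s)\,ds}$$ and $$\mathbb{P}\big(\|X\|_p\le(1-\varepsilon)\mathbb{E}\|X\|_p-x\big)\le e^{-\int_0^x h^{-1}(s)\,ds}.$$ -/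

import Mathlib

open MeasureTheory ProbabilityTheory Set

noncomputable section

/-- `ν` is a Lévy measure: a Borel measure without atom at the origin and such that
`∫ (1 ∧ ‖u‖²) ν(du) < ∞`. -/
structure IsLevyMeasure {E : Type*} [NormedAddCommGroup E] [MeasurableSpace E]
    (ν : Measure E) : Prop where
  no_atom_zero : ν {0} = 0
  lintegral_lt_top : ∫⁻ u, ENNReal.ofReal (min 1 (‖u‖ ^ 2)) ∂ν < ⊤

/-- The Lévy–Khintchine exponent, without Gaussian component, of drift `γ` and Lévy measure `ν`:
`i⟨t, γ⟩ + ∫ (e^{i⟨t, u⟩} - 1 - i⟨t, u⟩ 1_{‖u‖ ≤ 1}) ν(du)`. -/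
def levyExponent {E : Type*} [NormedAddCommGroup E] [InnerProductSpace ℝ E] [MeasurableSpace E]
    (γ : E) (ν : Measure E) (t : E) : ℂ :=
  Complex.I * ((inner ℝ t γ : ℝ) : ℂ) +
    ∫ u, (Complex.exp (Complex.I * ((inner ℝ t u : ℝ) : ℂ)) - 1 -
      (if ‖u‖ ≤ 1 then Complex.I * ((inner ℝ t u : ℝ) : ℂ) else 0)) ∂ν

/-- `μ` is the infinitely divisible law `ID(γ, 0, ν)`: `ν` is a Lévy measure, and the
characteristic function of `μ` is the exponential of the Lévy–Khintchine exponent. -/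
structure IsIDLaw {E : Type*} [NormedAddCommGroup E] [InnerProductSpace ℝ E] [MeasurableSpace E]
    (μ : Measure E) (γ : E) (ν : Measure E) : Prop where
  levy : IsLevyMeasure ν
  charFun_eq : ∀ t : E, charFun μ t = Complex.exp (levyExponent γ ν t)

/-- The `ℓ^p` norm `‖x‖_p` of a vector `x` of `ℝ^d`. -/
def ellNorm (p : ℝ) {d : ℕ} (x : EuclideanSpace ℝ (Fin d)) : ℝ :=
  ‖(WithLp.toLp (ENNReal.ofReal p) (fun k => x k) : PiLp (ENNReal.ofReal p) fun _ : Fin d => ℝ)‖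

/-- `M = sup {t > 0 : E e^{t|Y|} < ∞}`, an element of `[0, ∞]`. -/
def expMomentSup {Ω : Type*} [MeasurableSpace Ω] (P : Measure Ω) (Y : Ω → ℝ) : ENNReal :=
  sSup (ENNReal.ofReal '' {t : ℝ | 0 < t ∧ Integrable (fun ω => Real.exp (t * |Y ω|)) P})

/-- The integrand of `h` at `t`; here `m` stands for `E ‖X‖_p`. -/
def hIntegrand (d : ℕ) (p ε m t u : ℝ) : ℝ :=
  (1 + |u| * (d : ℝ) ^ (1 / (2 * p - 2)) / (ε * m)) ^ (2 * p - 2) *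
    (|u| * (Real.exp (t * |u|) - 1))

/-- The function `h`; here `m` stands for `E ‖X‖_p` and `ν₁` for the one-dimensional
Lévy measure of the coordinates. -/
def hFun (d : ℕ) (p ε m : ℝ) (ν₁ : Measure ℝ) (t : ℝ) : ℝ :=
  p ^ 2 * ∫ u, hIntegrand d p ε m t u ∂ν₁

/-- The interval `[0, M)` of real numbers, for `M ∈ [0, ∞]`. -/
def icoZero (M : ENNReal) : Set ℝ := {t : ℝ | 0 ≤ t ∧ ENNReal.ofReal t < M}

/-- `h(M^-)`, the limit in `[0, ∞]` of the non-negative and non-decreasing function `h`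
at the right end of `[0, M)`, that is, its supremum there. -/
def limAtEnd (h : ℝ → ℝ) (M : ENNReal) : ENNReal := ⨆ t ∈ icoZero M, ENNReal.ofReal (h t)

end

set_option linter.unusedSectionVars false

open scoped BoundedContinuousFunction Topology

/-! The proof is a covariance method. For a compound Poisson law with jump measure `ρ`, let two
copies `(Y, Z)` have either independent or identical jumps, with generators `B` and `D` on bounded
functions of `(y, z)`. Interpolating along `B + s(D - B)`, which for `s ∈ [0, 1]` still generates a
positive semigroup with both marginals unchanged, expresses `Cov(f, g)` through `∫ (f(Y+u) - f(Y))
(g(Z+u) - g(Z)) ρ(du)`. A pointwise bound of this integral by `c * g(Z)` thus gives `Cov(f, g) ≤ c *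
E g` (`opExp_jumpGen_cov_le`).

With `g = e^{rf}` this says that the logarithmic derivative of `r ↦ E e^{rf}` is at most `E f +
c(r)`, whence `E e^{tf} ≤ exp(t E f + ∫_0^t c)`. Removing small jumps from the Lévy measure and
passing to the weak limit extends the bound to the law of `X` (`IsIDLaw.laplace_le`).

The bound is not applied to `‖x‖_p` but to `f(x) = ‖(x, b)‖_p` with `b = ε E‖X‖_p`. It lies between
`‖x‖_p` and `‖x‖_p + b`, which costs the factors `1 ± ε`, and it is at least `b`, which controls the
sum over the axes of the squared increments (`sum_sq_shiftNorm_sub_le`). Since `ν` lives on the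
axes, convexity of `exp` and `ab ≤ (a² + b²)/2` then give exactly `c = h` (`setIntegral_jumps_le`).

Chernoff's bound yields `exp(-(t x - ∫_0^t h))`; at `t = h⁻¹(x)` the equality case of Young's
inequality turns the exponent into `-∫_0^x h⁻¹` (`integral_inverse_of_strictMonoOn`). Finiteness of
`h` follows by transferring exponential moments from the law to the large jumps of `ν`
(`IsIDLaw.integrableOn_exp`). -/

theorem HasSum.congr_terms {B : Type*} [AddCommMonoid B] [TopologicalSpace B] {f g : ℕ → B} {a : B}
    (hf : HasSum f a) (h : ∀ n, g n = f n) : HasSum g a := by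
  rwa [funext h]

/-! ### Exponentials of bounded operators. -/

section ExpOperator

variable {V W : Type*} [NormedAddCommGroup V] [NormedSpace ℝ V]
  [NormedAddCommGroup W] [NormedSpace ℝ W]

/-- The exponential of a bounded operator. -/
noncomputable def opExp (A : V →L[ℝ] V) : V →L[ℝ] V := NormedSpace.exp A

theorem opExp_smul_one (c : ℝ) :
    opExp (c • (1 : V →L[ℝ] V)) = Real.exp c • (1 : V →L[ℝ] V) := by
  have := NormedSpace.algebraMap_exp_comm (𝕂 := ℝ) (𝔸 := V →L[ℝ] V) c
  rw [Algebra.algebraMap_eq_smul_one, Algebra.algebraMap_eq_smul_one] at this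
  rw [opExp, ← this, Real.exp_eq_exp_ℝ]

theorem commute_sub_smul_one {A B : V →L[ℝ] V} (h : Commute A B) (a b : ℝ) :
    Commute (A - a • (1 : V →L[ℝ] V)) (B - b • (1 : V →L[ℝ] V)) :=
  (h.sub_left ((Commute.one_left B).smul_left a)).sub_right
    ((Commute.one_right (A - a • (1 : V →L[ℝ] V))).smul_right b)

variable [CompleteSpace V] [CompleteSpace W]

theorem hasSum_opExp_apply (A : V →L[ℝ] V) (x : V) :
    HasSum (fun n : ℕ => ((n.factorial : ℝ)⁻¹) • (A ^ n) x) (opExp A x) := by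
  have h := (NormedSpace.exp_series_hasSum_exp' (𝕂 := ℝ) A)
  simpa [opExp] using h.mapL (ContinuousLinearMap.apply ℝ V x)

/-- Used to reduce semigroups on pairs to semigroups on one variable: restriction to a horizontal
line, a vertical line or the diagonal intertwines their generators. -/
theorem map_opExp_apply_of_intertwine (A : V →L[ℝ] V) (B : W →L[ℝ] W)
    (J : V →L[ℝ] W) (h : ∀ x, J (A x) = B (J x)) (x : V) :
    J (opExp A x) = opExp B (J x) := by
  have hp : ∀ n : ℕ, ∀ x, J ((A ^ n) x) = (B ^ n) (J x) := by
    intro n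
    induction n with
    | zero => intro x; simp
    | succ n ih =>
      intro x
      rw [pow_succ, pow_succ]
      change J ((A ^ n) (A x)) = (B ^ n) (B (J x))
      rw [ih, h]
  have h1 := (hasSum_opExp_apply A x).mapL J
  have h2 := hasSum_opExp_apply B (J x)
  simp only [map_smul, hp] at h1
  exact h1.unique h2

theorem opExp_add (A B : V →L[ℝ] V) (h : Commute A B) : opExp (A + B) = opExp A * opExp B := by
  let _ : NormedAlgebra ℚ (V →L[ℝ] V) := NormedAlgebra.restrictScalars ℚ ℝ _
  exact NormedSpace.exp_add_of_commute h

theorem opExp_sub_smul_one (A : V →L[ℝ] V) (c : ℝ) :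
    opExp (A - c • (1 : V →L[ℝ] V)) = Real.exp (-c) • opExp A := by
  rw [sub_eq_add_neg, ← neg_smul, opExp_add _ _ ((Commute.one_right A).smul_right _),
    opExp_smul_one]
  simp

theorem hasDerivAt_opExp_smul_apply (A : V →L[ℝ] V) (x : V) (t : ℝ) :
    HasDerivAt (fun s : ℝ => opExp (s • A) x) (opExp (t • A) (A x)) t :=
  (hasDerivAt_exp_smul_const (𝕂 := ℝ) A t).clm_apply (hasDerivAt_const t x) |>.congr_deriv
    (by simp [opExp])

end ExpOperator

/-! ### Positive operators on bounded continuous functions. -/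

section PositiveOperator

variable {G : Type*} [TopologicalSpace G]

/-- Positivity of an operator on bounded continuous functions. -/
def IsPositiveOp (A : (G →ᵇ ℝ) →L[ℝ] (G →ᵇ ℝ)) : Prop :=
  ∀ F : G →ᵇ ℝ, (∀ x, 0 ≤ F x) → ∀ x, 0 ≤ A F x

theorem IsPositiveOp.smul {A : (G →ᵇ ℝ) →L[ℝ] (G →ᵇ ℝ)} (hA : IsPositiveOp A) {c : ℝ}
    (hc : 0 ≤ c) : IsPositiveOp (c • A) :=
  fun F hF x => mul_nonneg hc (hA F hF x)

theorem IsPositiveOp.pow {A : (G →ᵇ ℝ) →L[ℝ] (G →ᵇ ℝ)} (hA : IsPositiveOp A) (n : ℕ) :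
    IsPositiveOp (A ^ n) := by
  induction n with
  | zero => intro F hF x; simpa using hF x
  | succ n ih =>
    intro F hF x
    rw [pow_succ]
    exact ih _ (hA F hF) x

theorem hasSum_exp_apply_eval (A : (G →ᵇ ℝ) →L[ℝ] (G →ᵇ ℝ)) (F : G →ᵇ ℝ) (x : G) :
    HasSum (fun n : ℕ => ((n.factorial : ℝ)⁻¹) * ((A ^ n) F) x) (opExp A F x) := by
  simpa using (hasSum_opExp_apply A F).mapL (BoundedContinuousFunction.evalCLM ℝ x)

theorem IsPositiveOp.exp {A : (G →ᵇ ℝ) →L[ℝ] (G →ᵇ ℝ)} (hA : IsPositiveOp A) :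
    IsPositiveOp (opExp A) :=
  fun F hF x => (hasSum_exp_apply_eval A F x).nonneg
    fun n => mul_nonneg (inv_nonneg.2 (Nat.cast_nonneg _)) (hA.pow n F hF x)

/-- The generator itself is not positive, but subtracting a multiple of the identity only rescales
the exponential by `e^{-c} > 0`. -/
theorem IsPositiveOp.exp_sub_smul_one {A : (G →ᵇ ℝ) →L[ℝ] (G →ᵇ ℝ)} (hA : IsPositiveOp A)
    (c : ℝ) : IsPositiveOp (opExp (A - c • (1 : (G →ᵇ ℝ) →L[ℝ] (G →ᵇ ℝ)))) := by
  rw [opExp_sub_smul_one]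
  exact hA.exp.smul (Real.exp_pos _).le

theorem IsPositiveOp.mono {A : (G →ᵇ ℝ) →L[ℝ] (G →ᵇ ℝ)} (hA : IsPositiveOp A)
    {F F' : G →ᵇ ℝ} (h : ∀ x, F x ≤ F' x) (x : G) : A F x ≤ A F' x := by
  have := hA (F' - F) (fun y => sub_nonneg.2 (h y)) x
  rw [map_sub] at this
  exact sub_nonneg.1 this

end PositiveOperator

/-! ### Compound Poisson semigroups and laws. -/

section ConvOperator

variable {G : Type*} [NormedAddCommGroup G] [MeasurableSpace G] [BorelSpace G]
  [SecondCountableTopology G]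

/-- The operator `F ↦ (x ↦ ∫ F (x + u) ρ(du))` on bounded continuous functions. -/
noncomputable def convOp (ρ : Measure G) [IsFiniteMeasure ρ] :
    (G →ᵇ ℝ) →L[ℝ] (G →ᵇ ℝ) :=
  LinearMap.mkContinuous
    { toFun := fun F => BoundedContinuousFunction.ofNormedAddCommGroup
        (fun x => ∫ u, F (x + u) ∂ρ)
        (continuous_of_dominated
          (fun x => (F.continuous.comp (by fun_prop)).aestronglyMeasurable)
          (fun x => Filter.Eventually.of_forall fun u => F.norm_coe_le_norm _)
          (integrable_const ‖F‖)
          (Filter.Eventually.of_forall fun u => F.continuous.comp (by fun_prop)))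
        (‖F‖ * ρ.real univ)
        (fun x => norm_integral_le_of_norm_le_const
          (Filter.Eventually.of_forall fun u => F.norm_coe_le_norm _))
      map_add' := fun F F' => by
        ext x
        simp only [BoundedContinuousFunction.coe_ofNormedAddCommGroup,
          BoundedContinuousFunction.coe_add, Pi.add_apply]
        exact integral_add
          ((F.compContinuous ⟨fun u => x + u, by fun_prop⟩).integrable ρ)
          ((F'.compContinuous ⟨fun u => x + u, by fun_prop⟩).integrable ρ)
      map_smul' := fun c F => by
        ext x
        simp [integral_const_mul] }
    (ρ.real univ)
    (fun F => by
      rw [mul_comm]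
      refine (BoundedContinuousFunction.norm_le
        (mul_nonneg (norm_nonneg F) measureReal_nonneg)).2 fun x => ?_
      exact norm_integral_le_of_norm_le_const
        (Filter.Eventually.of_forall fun u => F.norm_coe_le_norm _))

variable (ρ σ : Measure G) [IsFiniteMeasure ρ] [IsFiniteMeasure σ]

@[simp]
theorem convOp_apply (F : G →ᵇ ℝ) (x : G) : convOp ρ F x = ∫ u, F (x + u) ∂ρ := rfl

theorem integrable_comp_add (F : G →ᵇ ℝ) (x : G) : Integrable (fun u => F (x + u)) ρ :=
  (F.compContinuous ⟨fun u => x + u, by fun_prop⟩).integrable ρ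

theorem isPositiveOp_convOp : IsPositiveOp (convOp ρ) :=
  fun _ hF _ => integral_nonneg fun _ => hF _

/-- Translations commute, and Fubini exchanges the two averages. All later factorizations of
exponentials of generators rest on this. -/
theorem commute_convOp : Commute (convOp ρ) (convOp σ) := by
  ext F x
  change ∫ u, ∫ v, F (x + u + v) ∂σ ∂ρ = ∫ v, ∫ u, F (x + v + u) ∂ρ ∂σ
  rw [integral_integral_swap]
  · simp only [add_right_comm]
  · exact (F.compContinuous ⟨fun q : G × G => x + q.1 + q.2, by fun_prop⟩).integrable (ρ.prod σ)

theorem convOp_add : convOp (ρ + σ) = convOp ρ + convOp σ := by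
  ext F x
  simp only [_root_.add_apply, BoundedContinuousFunction.coe_add, Pi.add_apply,
    convOp_apply]
  exact integral_add_measure (integrable_comp_add ρ F x) (integrable_comp_add σ F x)

/-- The infinitesimal generator of the compound Poisson semigroup with jump measure `ρ`. -/
noncomputable def jumpGen : (G →ᵇ ℝ) →L[ℝ] (G →ᵇ ℝ) :=
  convOp ρ - ρ.real univ • (1 : (G →ᵇ ℝ) →L[ℝ] (G →ᵇ ℝ))

theorem commute_jumpGen : Commute (jumpGen ρ) (jumpGen σ) := by
  unfold jumpGen
  exact commute_sub_smul_one (commute_convOp ρ σ) _ _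

theorem jumpGen_add : jumpGen (ρ + σ) = jumpGen ρ + jumpGen σ := by
  unfold jumpGen
  rw [convOp_add, measureReal_add_apply, add_smul]
  abel

/-- Iterated convolution powers of a measure. -/
noncomputable def convPow (ρ : Measure G) : ℕ → Measure G
  | 0 => Measure.dirac 0
  | n + 1 => (convPow ρ n).conv ρ

instance instIsFiniteMeasureConvPow (n : ℕ) : IsFiniteMeasure (convPow ρ n) := by
  induction n with
  | zero => unfold convPow; infer_instance
  | succ n ih => unfold convPow; infer_instance

theorem integral_convPow (n : ℕ) (F : G →ᵇ ℝ) :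
    ∫ x, F x ∂(convPow ρ n) = ((convOp ρ) ^ n) F 0 := by
  induction n generalizing F with
  | zero => simp [convPow]
  | succ n ih =>
    rw [convPow, integral_conv (F.integrable _), pow_succ]
    exact ih (convOp ρ F)

theorem real_univ_convPow (n : ℕ) : (convPow ρ n).real univ = ρ.real univ ^ n := by
  have h := integral_convPow ρ n 1
  have h1 : convOp ρ 1 = ρ.real univ • (1 : G →ᵇ ℝ) := by ext x; simp
  have h2 : ((convOp ρ) ^ n) 1 = ρ.real univ ^ n • (1 : G →ᵇ ℝ) := by
    induction n with
    | zero => simp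
    | succ n ih =>
      rw [pow_succ]
      change ((convOp ρ) ^ n) (convOp ρ 1) = _
      rw [h1, map_smul, ih (integral_convPow ρ n 1), smul_smul, pow_succ, mul_comm]
  rw [h2] at h
  simpa using h

/-- The compound Poisson law with jump measure `ρ`. -/
noncomputable def compoundPoisson (ρ : Measure G) : Measure G :=
  Measure.sum fun n : ℕ =>
    ENNReal.ofReal (Real.exp (-ρ.real univ) * (n.factorial : ℝ)⁻¹) • convPow ρ n

instance instIsProbabilityMeasureCompoundPoisson : IsProbabilityMeasure (compoundPoisson ρ) := by
  constructor
  have h : HasSum (fun n : ℕ => Real.exp (-ρ.real univ) * (n.factorial : ℝ)⁻¹ *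
      (convPow ρ n).real univ) 1 := by
    have := (NormedSpace.exp_series_hasSum_exp' (𝕂 := ℝ) (ρ.real univ)).mul_left
      (Real.exp (-ρ.real univ))
    rw [← Real.exp_eq_exp_ℝ, ← Real.exp_add, neg_add_cancel, Real.exp_zero] at this
    refine this.congr_terms fun n => ?_
    rw [real_univ_convPow, smul_eq_mul]; ring
  rw [compoundPoisson, Measure.sum_apply _ MeasurableSet.univ]
  have h2 : ∀ n, (ENNReal.ofReal (Real.exp (-ρ.real univ) * (n.factorial : ℝ)⁻¹) •
      convPow ρ n) univ = ENNReal.ofReal (Real.exp (-ρ.real univ) * (n.factorial : ℝ)⁻¹ *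
      (convPow ρ n).real univ) := by
    intro n
    rw [Measure.smul_apply, smul_eq_mul, ENNReal.ofReal_mul (by positivity),
      ENNReal.ofReal_mul (by positivity), ENNReal.ofReal_mul (by positivity),
      ofReal_measureReal]
  rw [tsum_congr h2, ← ENNReal.ofReal_tsum_of_nonneg (fun n => by positivity) h.summable, h.tsum_eq]
  simp

theorem hasSum_integral_compoundPoisson {B : Type*} [NormedAddCommGroup B] [NormedSpace ℝ B]
    {F : G → B} (hF : Integrable F (compoundPoisson ρ)) :
    HasSum (fun n : ℕ => (Real.exp (-ρ.real univ) * (n.factorial : ℝ)⁻¹) •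
      ∫ x, F x ∂(convPow ρ n)) (∫ x, F x ∂(compoundPoisson ρ)) := by
  have h := hasSum_integral_measure (f := F) hF
  refine h.congr_terms fun n => ?_
  rw [integral_smul_measure, ENNReal.toReal_ofReal (by positivity)]

/-- Both sides are the same series: the `n`-fold convolution power integrates `F` as the `n`-th
power of the convolution operator evaluated at `0`. -/
theorem integral_compoundPoisson (F : G →ᵇ ℝ) :
    ∫ x, F x ∂(compoundPoisson ρ) = opExp (jumpGen ρ) F 0 := by
  have h := hasSum_integral_compoundPoisson ρ (F.integrable (compoundPoisson ρ))
  have h2 := (hasSum_exp_apply_eval (convOp ρ) F 0).mul_left (Real.exp (-ρ.real univ))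
  rw [jumpGen, opExp_sub_smul_one]
  simp only [_root_.smul_apply, BoundedContinuousFunction.coe_smul, smul_eq_mul]
  refine h.unique ?_
  refine h2.congr_terms fun n => ?_
  rw [integral_convPow, smul_eq_mul, mul_assoc]

end ConvOperator

/-! ### Characteristic functions of compound Poisson laws. -/

section CharFun

variable {E : Type*} [NormedAddCommGroup E] [InnerProductSpace ℝ E] [MeasurableSpace E]
  [BorelSpace E] [SecondCountableTopology E] (ρ : Measure E) [IsFiniteMeasure ρ]

theorem charFun_convPow (n : ℕ) (t : E) : charFun (convPow ρ n) t = charFun ρ t ^ n := by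
  induction n with
  | zero => simp [convPow]
  | succ n ih => rw [convPow, charFun_conv, ih, pow_succ]

theorem charFun_compoundPoisson (t : E) :
    charFun (compoundPoisson ρ) t = Complex.exp (charFun ρ t - ρ.real univ) := by
  have hi : Integrable (fun x => Complex.exp (inner ℝ x t * Complex.I)) (compoundPoisson ρ) := by
    refine Integrable.of_bound (C := 1) (by fun_prop) (Filter.Eventually.of_forall fun x => ?_)
    rw [Complex.norm_exp_ofReal_mul_I]
  have h := hasSum_integral_compoundPoisson ρ hi
  rw [← charFun_apply] at h
  refine h.unique ?_
  have h2 := (NormedSpace.exp_series_hasSum_exp' (𝕂 := ℂ) (charFun ρ t)).mul_left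
      (Complex.exp (-ρ.real univ))
  rw [← Complex.exp_eq_exp_ℂ, ← Complex.exp_add, neg_add_eq_sub] at h2
  refine h2.congr_terms fun n => ?_
  rw [← charFun_apply, charFun_convPow, Complex.real_smul]
  push_cast
  rw [smul_eq_mul]
  ring

end CharFun

/-! ### Covariance inequality by interpolation between independent and identical copies. -/

theorem opExp_apply_of_apply_eq_zero {V : Type*} [NormedAddCommGroup V] [NormedSpace ℝ V]
    [CompleteSpace V] {A : V →L[ℝ] V} {x : V} (h : A x = 0) : opExp A x = x := by
  have h1 := hasSum_opExp_apply A x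
  have h2 : HasSum (fun n : ℕ => ((n.factorial : ℝ)⁻¹) • (A ^ n) x) x := by
    convert hasSum_single (α := V) 0 (f := fun n : ℕ => ((n.factorial : ℝ)⁻¹) • (A ^ n) x) ?_ using 1
    · simp
    · intro n hn
      obtain ⟨k, rfl⟩ := Nat.exists_eq_succ_of_ne_zero hn
      rw [Nat.succ_eq_add_one, pow_succ]
      change _ • (A ^ k) (A x) = 0
      rw [h, map_zero, smul_zero]
  exact h1.unique h2

theorem commute_sub_self_of_commute {V : Type*} [NormedAddCommGroup V] [NormedSpace ℝ V]
    {A D : V →L[ℝ] V} (h : Commute A D) : Commute A (D - A) :=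
  h.sub_right (Commute.refl A)

theorem smul_sub_smul_one {V : Type*} [NormedAddCommGroup V] [NormedSpace ℝ V]
    (A : V →L[ℝ] V) (s c : ℝ) :
    s • (A - c • (1 : V →L[ℝ] V)) = s • A - (s * c) • (1 : V →L[ℝ] V) := by
  rw [smul_sub, smul_smul]

theorem commute_smul_smul {V : Type*} [NormedAddCommGroup V] [NormedSpace ℝ V]
    {A D : V →L[ℝ] V} (h : Commute A D) (a b : ℝ) : Commute (a • A) (b • D) :=
  (h.smul_left a).smul_right b

theorem add_smul_sub_self {V : Type*} [NormedAddCommGroup V] [NormedSpace ℝ V]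
    (A D : V →L[ℝ] V) (s : ℝ) : A + s • (D - A) = (1 - s) • A + s • D := by
  rw [smul_sub, sub_smul, one_smul]
  abel

section Pullback

variable {S S' : Type*} [TopologicalSpace S] [TopologicalSpace S']

/-- Composition with a continuous map, as an operator on bounded continuous functions. -/
noncomputable def pullbackOp (φ : C(S, S')) : (S' →ᵇ ℝ) →L[ℝ] (S →ᵇ ℝ) :=
  LinearMap.mkContinuous
    { toFun := fun F => F.compContinuous φ
      map_add' := fun _ _ => rfl
      map_smul' := fun _ _ => rfl } 1
    (fun F => by
      rw [one_mul]
      exact (BoundedContinuousFunction.norm_le (norm_nonneg F)).2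
        fun x => F.norm_coe_le_norm _)

@[simp]
theorem pullbackOp_apply (φ : C(S, S')) (F : S' →ᵇ ℝ) (x : S) : pullbackOp φ F x = F (φ x) := rfl

end Pullback

section Covariance

variable {E : Type*} [NormedAddCommGroup E] [MeasurableSpace E] [BorelSpace E]
  [SecondCountableTopology E]

/-- The function `(y, z) ↦ f y * g z`. -/
noncomputable def tensorFun (f g : E →ᵇ ℝ) : (E × E) →ᵇ ℝ :=
  f.compContinuous ⟨Prod.fst, continuous_fst⟩ * g.compContinuous ⟨Prod.snd, continuous_snd⟩

@[simp]
theorem tensorFun_apply (f g : E →ᵇ ℝ) (x : E × E) : tensorFun f g x = f x.1 * g x.2 := rfl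

variable (ρ : Measure E) [IsFiniteMeasure ρ]

@[simp]
theorem jumpGen_apply (F : E →ᵇ ℝ) (x : E) :
    jumpGen ρ F x = ∫ u, F (x + u) ∂ρ - ρ.real univ * F x := rfl

theorem jumpGen_one : jumpGen ρ 1 = 0 := by
  ext x
  simp

theorem opExp_jumpGen_one : opExp (jumpGen ρ) 1 = 1 :=
  opExp_apply_of_apply_eq_zero (jumpGen_one ρ)

theorem isPositiveOp_opExp_smul_jumpGen {s : ℝ} (hs : 0 ≤ s) :
    IsPositiveOp (opExp (s • jumpGen ρ)) := by
  rw [jumpGen, smul_sub_smul_one]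
  exact ((isPositiveOp_convOp ρ).smul hs).exp_sub_smul_one _

theorem jumpGen_map_apply {G : Type*} [NormedAddCommGroup G] [MeasurableSpace G] [BorelSpace G]
    [SecondCountableTopology G] {φ : E → G} (hφ : Continuous φ) (F : G →ᵇ ℝ) (x : G) :
    jumpGen (ρ.map φ) F x = ∫ u, F (x + φ u) ∂ρ - ρ.real univ * F x := by
  rw [jumpGen_apply, integral_map hφ.measurable.aemeasurable
    (by exact (F.continuous.comp (continuous_const.add continuous_id)).aestronglyMeasurable),
    map_measureReal_apply hφ.measurable MeasurableSet.univ, preimage_univ]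

/-- Generator of jumps of the first variable. -/
noncomputable def jumpFst : ((E × E) →ᵇ ℝ) →L[ℝ] ((E × E) →ᵇ ℝ) :=
  jumpGen (ρ.map fun u : E => ((u, 0) : E × E))

/-- Generator of jumps of the second variable. -/
noncomputable def jumpSnd : ((E × E) →ᵇ ℝ) →L[ℝ] ((E × E) →ᵇ ℝ) :=
  jumpGen (ρ.map fun u : E => ((0, u) : E × E))

/-- Generator of simultaneous jumps of both variables. -/
noncomputable def jumpDiag : ((E × E) →ᵇ ℝ) →L[ℝ] ((E × E) →ᵇ ℝ) :=
  jumpGen (ρ.map fun u : E => ((u, u) : E × E))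

theorem jumpFst_apply (F : (E × E) →ᵇ ℝ) (x : E × E) :
    jumpFst ρ F x = ∫ u, F (x.1 + u, x.2) ∂ρ - ρ.real univ * F x := by
  rw [jumpFst, jumpGen_map_apply ρ (by fun_prop)]
  simp [Prod.add_def]

theorem jumpSnd_apply (F : (E × E) →ᵇ ℝ) (x : E × E) :
    jumpSnd ρ F x = ∫ u, F (x.1, x.2 + u) ∂ρ - ρ.real univ * F x := by
  rw [jumpSnd, jumpGen_map_apply ρ (by fun_prop)]
  simp [Prod.add_def]

theorem jumpDiag_apply (F : (E × E) →ᵇ ℝ) (x : E × E) :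
    jumpDiag ρ F x = ∫ u, F (x.1 + u, x.2 + u) ∂ρ - ρ.real univ * F x := by
  rw [jumpDiag, jumpGen_map_apply ρ (by fun_prop)]
  simp [Prod.add_def]

theorem opExp_jumpFst_tensorFun (f g : E →ᵇ ℝ) :
    opExp (jumpFst ρ) (tensorFun f g) = tensorFun (opExp (jumpGen ρ) f) g := by
  ext x
  have h := map_opExp_apply_of_intertwine (jumpFst ρ) (jumpGen ρ)
    (pullbackOp ⟨fun y : E => (y, x.2), by fun_prop⟩)
    (fun F => by ext y; simp [jumpFst_apply]) (tensorFun f g)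
  have h2 : pullbackOp ⟨fun y : E => (y, x.2), by fun_prop⟩ (tensorFun f g) = g x.2 • f := by
    ext y; simp [mul_comm]
  rw [h2, map_smul] at h
  have h3 := DFunLike.congr_fun h x.1
  simp only [pullbackOp_apply, ContinuousMap.coe_mk, Prod.mk.eta,
    BoundedContinuousFunction.coe_smul, smul_eq_mul] at h3
  rw [h3, tensorFun_apply, mul_comm]

theorem opExp_jumpSnd_tensorFun (f g : E →ᵇ ℝ) :
    opExp (jumpSnd ρ) (tensorFun f g) = tensorFun f (opExp (jumpGen ρ) g) := by
  ext x
  have h := map_opExp_apply_of_intertwine (jumpSnd ρ) (jumpGen ρ)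
    (pullbackOp ⟨fun y : E => (x.1, y), by fun_prop⟩)
    (fun F => by ext y; simp [jumpSnd_apply]) (tensorFun f g)
  have h2 : pullbackOp ⟨fun y : E => (x.1, y), by fun_prop⟩ (tensorFun f g) = f x.1 • g := by
    ext y; simp
  rw [h2, map_smul] at h
  have h3 := DFunLike.congr_fun h x.2
  simp only [pullbackOp_apply, ContinuousMap.coe_mk, Prod.mk.eta,
    BoundedContinuousFunction.coe_smul, smul_eq_mul] at h3
  rw [h3, tensorFun_apply]

theorem opExp_jumpDiag_tensorFun (f g : E →ᵇ ℝ) (x : E) :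
    opExp (jumpDiag ρ) (tensorFun f g) (x, x) = opExp (jumpGen ρ) (f * g) x := by
  have h := map_opExp_apply_of_intertwine (jumpDiag ρ) (jumpGen ρ)
    (pullbackOp ⟨fun y : E => (y, y), by fun_prop⟩)
    (fun F => by ext y; simp [jumpDiag_apply]) (tensorFun f g)
  have h2 : pullbackOp ⟨fun y : E => (y, y), by fun_prop⟩ (tensorFun f g) = f * g := by
    ext y; simp
  rw [h2] at h
  exact DFunLike.congr_fun h x

theorem opExp_jumpFst_add_jumpSnd (f g : E →ᵇ ℝ) :
    opExp (jumpFst ρ + jumpSnd ρ) (tensorFun f g) =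
      tensorFun (opExp (jumpGen ρ) f) (opExp (jumpGen ρ) g) := by
  have h : Commute (jumpFst ρ) (jumpSnd ρ) := commute_jumpGen _ _
  rw [opExp_add _ _ h]
  change opExp (jumpFst ρ) (opExp (jumpSnd ρ) _) = _
  rw [opExp_jumpSnd_tensorFun, opExp_jumpFst_tensorFun]

/-- Expanding the product of increments, the total-mass terms of the three generators combine into
the single term `f y * g z`. -/
theorem jumpDiag_sub_apply_tensorFun (f g : E →ᵇ ℝ) (x : E × E) :
    (jumpDiag ρ - (jumpFst ρ + jumpSnd ρ)) (tensorFun f g) x =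
      ∫ u, (f (x.1 + u) - f x.1) * (g (x.2 + u) - g x.2) ∂ρ := by
  change jumpDiag ρ (tensorFun f g) x - (jumpFst ρ (tensorFun f g) x + jumpSnd ρ (tensorFun f g) x)
    = _
  rw [jumpDiag_apply, jumpFst_apply, jumpSnd_apply]
  simp only [tensorFun_apply]
  have hf := integrable_comp_add ρ f x.1
  have hg := integrable_comp_add ρ g x.2
  have hfg : Integrable (fun u => f (x.1 + u) * g (x.2 + u)) ρ := by
    refine hf.mul_bdd (c := ‖g‖) hg.aestronglyMeasurable
      (Filter.Eventually.of_forall fun u => g.norm_coe_le_norm _)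
  have : ∀ u, (f (x.1 + u) - f x.1) * (g (x.2 + u) - g x.2) =
      f (x.1 + u) * g (x.2 + u) - f (x.1 + u) * g x.2 - f x.1 * g (x.2 + u) + f x.1 * g x.2 :=
    fun u => by ring
  simp only [this]
  have h1 : Integrable (fun u => f (x.1 + u) * g (x.2 + u) - f (x.1 + u) * g x.2) ρ :=
    hfg.sub (hf.mul_const _)
  have h2 : Integrable (fun u => f (x.1 + u) * g (x.2 + u) - f (x.1 + u) * g x.2 -
    f x.1 * g (x.2 + u)) ρ := h1.sub (hg.const_mul _)
  rw [integral_add h2 (integrable_const _), integral_sub h1 (hg.const_mul _),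
    integral_sub hfg (hf.mul_const _)]
  simp
  ring

/-- Covariance inequality for compound Poisson semigroups. -/
theorem opExp_jumpGen_cov_le (f g : E →ᵇ ℝ) (c : ℝ)
    (H : ∀ y z, ∫ u, (f (y + u) - f y) * (g (z + u) - g z) ∂ρ ≤ c * g z) :
    opExp (jumpGen ρ) (f * g) 0 - opExp (jumpGen ρ) f 0 * opExp (jumpGen ρ) g 0 ≤
      c * opExp (jumpGen ρ) g 0 := by
  set B := jumpFst ρ + jumpSnd ρ with hB
  set Q := jumpDiag ρ - B with hQ
  have hBD : Commute B (jumpDiag ρ) :=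
    (commute_jumpGen _ _).add_left (commute_jumpGen _ _)
  have hBQ : Commute B Q := commute_sub_self_of_commute hBD
  have hderiv : ∀ s : ℝ, HasDerivAt
      (fun s : ℝ => opExp B (opExp (s • Q) (tensorFun f g)) (0, 0))
      (opExp B (opExp (s • Q) (Q (tensorFun f g))) (0, 0)) s := by
    intro s
    have h1 := hasDerivAt_opExp_smul_apply Q (tensorFun f g) s
    have h2 := ((opExp B).hasFDerivAt.comp_hasDerivAt s h1)
    exact ((BoundedContinuousFunction.evalCLM ℝ ((0, 0) : E × E)).hasFDerivAt.comp_hasDerivAt s h2)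
  -- The mean value theorem replaces integration over `s`: the bound obtained below is the same for
  -- every `s`, so a single intermediate point suffices.
  obtain ⟨s, hs, hs'⟩ := exists_hasDerivAt_eq_slope
    (fun s : ℝ => opExp B (opExp (s • Q) (tensorFun f g)) (0, 0)) _ zero_lt_one
    (fun s _ => (hderiv s).continuousAt.continuousWithinAt) (fun s _ => hderiv s)
  have h0 : opExp B (opExp ((0 : ℝ) • Q) (tensorFun f g)) (0, 0) =
      opExp (jumpGen ρ) f 0 * opExp (jumpGen ρ) g 0 := by
    have h00 : ((0 : ℝ) • Q) (tensorFun f g) = 0 := zero_smul ℝ (Q (tensorFun f g))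
    rw [opExp_apply_of_apply_eq_zero h00, hB, opExp_jumpFst_add_jumpSnd]
    rfl
  have h1 : opExp B (opExp ((1 : ℝ) • Q) (tensorFun f g)) (0, 0) =
      opExp (jumpGen ρ) (f * g) 0 := by
    rw [← opExp_jumpDiag_tensorFun]
    change (opExp B * opExp ((1 : ℝ) • Q)) (tensorFun f g) (0, 0) = _
    rw [one_smul, ← opExp_add _ _ hBQ, hQ, add_sub_cancel]
  rw [h1, h0, sub_zero, div_one] at hs'
  rw [← hs']
  -- On `(0, 1)` the interpolated generator is a combination of jump generators with nonnegative
  -- weights `1 - s` and `s`, although `Q` alone generates nothing positive.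
  have hpos : IsPositiveOp (opExp B * opExp (s • Q)) := by
    have hsplit : B + s • Q = (1 - s) • B + s • jumpDiag ρ := add_smul_sub_self _ _ _
    have hBsQ : Commute B (s • Q) := by simpa using commute_smul_smul hBQ 1 s
    rw [← opExp_add _ _ hBsQ, hsplit,
      opExp_add _ _ (commute_smul_smul hBD _ _), hB, jumpFst, jumpSnd, ← jumpGen_add]
    intro F hF
    exact isPositiveOp_opExp_smul_jumpGen _ (by linarith [hs.2]) _
      (isPositiveOp_opExp_smul_jumpGen _ hs.1.le F hF)
  -- A constant first factor has no increments. Hence `exp(sQ)` fixes `1 ⊗ g`, which makes the upper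
  -- bound independent of `s`.
  have hQ1 : Q (tensorFun 1 g) = 0 := by
    ext x
    rw [hQ, hB, jumpDiag_sub_apply_tensorFun]
    simp
  have hle := hpos.mono (F := Q (tensorFun f g)) (F' := c • tensorFun 1 g) (fun x => by
    rw [hQ, hB, jumpDiag_sub_apply_tensorFun]
    simpa using H x.1 x.2) (0, 0)
  refine hle.trans_eq ?_
  change opExp B (opExp (s • Q) (c • tensorFun 1 g)) (0, 0) = _
  have hsQ : (s • Q) (c • tensorFun 1 g) = 0 := by
    change s • Q (c • tensorFun 1 g) = 0
    rw [map_smul, hQ1, smul_zero, smul_zero]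
  rw [opExp_apply_of_apply_eq_zero hsQ, map_smul, hB, opExp_jumpFst_add_jumpSnd,
    opExp_jumpGen_one]
  simp

/-- Covariance inequality for compound Poisson laws. -/
theorem compoundPoisson_cov_le (f g : E →ᵇ ℝ) (c : ℝ)
    (H : ∀ y z, ∫ u, (f (y + u) - f y) * (g (z + u) - g z) ∂ρ ≤ c * g z) :
    ∫ x, f x * g x ∂(compoundPoisson ρ) -
      (∫ x, f x ∂(compoundPoisson ρ)) * ∫ x, g x ∂(compoundPoisson ρ) ≤
      c * ∫ x, g x ∂(compoundPoisson ρ) := by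
  have h := opExp_jumpGen_cov_le ρ f g c H
  rwa [← integral_compoundPoisson, ← integral_compoundPoisson, ← integral_compoundPoisson] at h

end Covariance

/-! ### Lévy–Khintchine kernel and truncation of small jumps. -/

section LevyMeasure

variable {E : Type*} [NormedAddCommGroup E] [InnerProductSpace ℝ E] [MeasurableSpace E]
  [BorelSpace E]

/-- The integrand of the Lévy–Khintchine exponent. -/
noncomputable def levyKernel (t u : E) : ℂ :=
  Complex.exp (Complex.I * ((inner ℝ t u : ℝ) : ℂ)) - 1 -
      (if ‖u‖ ≤ 1 then Complex.I * ((inner ℝ t u : ℝ) : ℂ) else 0)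

theorem levyExponent_eq (γ : E) (ν : Measure E) (t : E) :
    levyExponent γ ν t = Complex.I * ((inner ℝ t γ : ℝ) : ℂ) + ∫ u, levyKernel t u ∂ν := rfl

theorem norm_exp_I_mul_sub_one_sub_le (x : ℝ) :
    ‖Complex.exp (Complex.I * (x : ℂ)) - 1 - Complex.I * (x : ℂ)‖ ≤ 3 * x ^ 2 := by
  have hn : ‖Complex.I * (x : ℂ)‖ = |x| := by simp
  rcases le_or_gt |x| 1 with h | h
  · refine (Complex.norm_exp_sub_one_sub_id_le (hn.trans_le h)).trans ?_
    rw [hn, sq_abs]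
    nlinarith [sq_nonneg x]
  · have h1 : ‖Complex.exp (Complex.I * (x : ℂ))‖ = 1 := by
      rw [mul_comm]; exact Complex.norm_exp_ofReal_mul_I x
    calc _ ≤ ‖Complex.exp (Complex.I * (x : ℂ))‖ + ‖(1 : ℂ)‖ + ‖Complex.I * (x : ℂ)‖ := by
          refine (norm_sub_le _ _).trans ?_
          gcongr
          exact norm_sub_le _ _
      _ = 2 + |x| := by rw [h1, hn]; norm_num
      _ ≤ 3 * x ^ 2 := by rw [← sq_abs]; nlinarith

theorem norm_levyKernel_le (t u : E) :
    ‖levyKernel t u‖ ≤ (2 + 3 * ‖t‖ ^ 2) * min 1 (‖u‖ ^ 2) := by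
  unfold levyKernel
  split_ifs with h
  · refine (norm_exp_I_mul_sub_one_sub_le _).trans ?_
    have h1 : ‖u‖ ^ 2 ≤ 1 := by nlinarith [norm_nonneg u]
    rw [min_eq_right h1, ← sq_abs]
    have h2 : |inner ℝ t u| ^ 2 ≤ (‖t‖ * ‖u‖) ^ 2 := by
      gcongr; exact abs_real_inner_le_norm t u
    nlinarith [sq_nonneg ‖u‖]
  · push Not at h
    have h1 : 1 ≤ ‖u‖ ^ 2 := by nlinarith
    rw [min_eq_left h1, sub_zero]
    refine (norm_sub_le _ _).trans ?_
    rw [mul_comm, Complex.norm_exp_ofReal_mul_I]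
    norm_num

theorem measurable_levyKernel [SecondCountableTopology E] (t : E) :
    Measurable (levyKernel t) := by
  unfold levyKernel
  refine Measurable.sub (by fun_prop) (Measurable.ite ?_ (by fun_prop) measurable_const)
  exact measurableSet_le measurable_norm measurable_const

end LevyMeasure

section Trunc

theorem IsLevyMeasure.integrable_min {E : Type*} [NormedAddCommGroup E] [MeasurableSpace E]
    [BorelSpace E] {ν : Measure E} (h : IsLevyMeasure ν) :
    Integrable (fun u => min 1 (‖u‖ ^ 2)) ν := by
  refine ⟨(by fun_prop), ?_⟩
  rw [hasFiniteIntegral_iff_ofReal (Filter.Eventually.of_forall fun u => by positivity)]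
  exact h.lintegral_lt_top

theorem IsLevyMeasure.measure_norm_gt_lt_top {E : Type*} [NormedAddCommGroup E]
    [MeasurableSpace E] [BorelSpace E] {ν : Measure E} (h : IsLevyMeasure ν) {δ : ℝ} (hδ : 0 < δ) :
    ν {u | δ < ‖u‖} < ⊤ := by
  have h1 := h.integrable_min.measure_ge_lt_top (ε := min 1 (δ ^ 2)) (by positivity)
  refine lt_of_le_of_lt (measure_mono fun u hu => ?_) h1
  simp only [mem_ofPred_eq] at hu ⊢
  gcongr

theorem IsLevyMeasure.restrict {E : Type*} [NormedAddCommGroup E]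
    [MeasurableSpace E] {ν : Measure E} (h : IsLevyMeasure ν) (s : Set E) :
    IsLevyMeasure (ν.restrict s) where
  no_atom_zero := Measure.absolutelyContinuous_of_le Measure.restrict_le_self h.no_atom_zero
  lintegral_lt_top := (lintegral_mono' Measure.restrict_le_self le_rfl).trans_lt h.lintegral_lt_top

variable {E : Type*} [NormedAddCommGroup E] [InnerProductSpace ℝ E] [MeasurableSpace E]
  [BorelSpace E]

/-- The set of jumps of size larger than `1 / (n + 1)`. -/
def jumpsAbove (E : Type*) [NormedAddCommGroup E] (n : ℕ) : Set E :=
  {u | 1 / ((n : ℝ) + 1) < ‖u‖}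

theorem measurableSet_jumpsAbove (n : ℕ) : MeasurableSet (jumpsAbove E n) :=
  measurableSet_lt measurable_const measurable_norm

theorem IsLevyMeasure.isFiniteMeasure_restrict {ν : Measure E} (h : IsLevyMeasure ν) (n : ℕ) :
    IsFiniteMeasure (ν.restrict (jumpsAbove E n)) :=
  ⟨by
    rw [Measure.restrict_apply_univ]
    exact h.measure_norm_gt_lt_top (by positivity)⟩

theorem iUnion_jumpsAbove : ⋃ n, jumpsAbove E n = {0}ᶜ := by
  ext u
  simp only [jumpsAbove, mem_iUnion, mem_ofPred_eq, mem_compl_iff, mem_singleton_iff]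
  constructor
  · rintro ⟨n, hn⟩ rfl
    rw [norm_zero] at hn
    exact absurd hn (not_lt.2 (by positivity))
  · intro hu
    exact exists_nat_one_div_lt (norm_pos_iff.2 hu)

theorem monotone_jumpsAbove : Monotone (jumpsAbove E) := by
  intro n m hnm u hu
  simp only [jumpsAbove, mem_ofPred_eq] at hu ⊢
  refine lt_of_le_of_lt ?_ hu
  gcongr

variable [SecondCountableTopology E]

theorem IsLevyMeasure.integrable_levyKernel {ν : Measure E} (h : IsLevyMeasure ν) (t : E) :
    Integrable (levyKernel t) ν :=
  (h.integrable_min.const_mul (2 + 3 * ‖t‖ ^ 2)).mono' (measurable_levyKernel t).aestronglyMeasurable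
    (Filter.Eventually.of_forall fun u => norm_levyKernel_le t u)

theorem IsLevyMeasure.tendsto_levyExponent {ν : Measure E} (h : IsLevyMeasure ν) (γ t : E) :
    Filter.Tendsto (fun n => levyExponent γ (ν.restrict (jumpsAbove E n)) t) Filter.atTop
      (𝓝 (levyExponent γ ν t)) := by
  simp only [levyExponent_eq]
  refine Filter.Tendsto.const_add _ ?_
  have h1 := tendsto_setIntegral_of_monotone (f := levyKernel t) (μ := ν)
    (fun n => measurableSet_jumpsAbove (E := E) n)
    monotone_jumpsAbove
    (h.integrable_levyKernel t).integrableOn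
  rw [iUnion_jumpsAbove] at h1
  convert h1 using 2
  rw [Measure.restrict_eq_self_of_ae_mem]
  rw [ae_iff]
  simpa using h.no_atom_zero

theorem IsLevyMeasure.continuousAt_levyExponent {ν : Measure E} (h : IsLevyMeasure ν) (γ t₀ : E) :
    ContinuousAt (levyExponent γ ν) t₀ := by
  have : levyExponent γ ν = fun t => Complex.I * ((inner ℝ t γ : ℝ) : ℂ) +
      ∫ u, levyKernel t u ∂ν := rfl
  rw [this]
  refine ContinuousAt.add (by fun_prop) ?_
  refine continuousAt_of_dominated (bound := fun u => (2 + 3 * (‖t₀‖ + 1) ^ 2) * min 1 (‖u‖ ^ 2))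
    (Filter.Eventually.of_forall fun t => (measurable_levyKernel t).aestronglyMeasurable) ?_
    (h.integrable_min.const_mul _) (Filter.Eventually.of_forall fun u => ?_)
  · filter_upwards [Metric.ball_mem_nhds t₀ one_pos] with t ht
    refine Filter.Eventually.of_forall fun u => (norm_levyKernel_le t u).trans ?_
    have : ‖t‖ ≤ ‖t₀‖ + 1 := by
      have := norm_sub_norm_le t t₀
      rw [mem_ball_iff_norm] at ht
      linarith
    gcongr
  · unfold levyKernel
    split_ifs <;> fun_prop

end Trunc

/-! ### Infinitely divisible laws with finite Lévy measure. -/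

section LevyLaw

variable {E : Type*} [NormedAddCommGroup E] [InnerProductSpace ℝ E] [FiniteDimensional ℝ E]
  [MeasurableSpace E] [BorelSpace E] [SecondCountableTopology E]

/-- The infinitely divisible law with drift `γ` and finite Lévy measure `ρ`. -/
noncomputable def finiteLevyLaw (γ : E) (ρ : Measure E) : Measure E :=
  (compoundPoisson ρ).map (fun x => x + (γ - ∫ u in Metric.closedBall 0 1, u ∂ρ))

variable (γ : E) (ρ : Measure E) [IsFiniteMeasure ρ]

instance instIsProbabilityMeasureFiniteLevyLaw : IsProbabilityMeasure (finiteLevyLaw γ ρ) :=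
  Measure.isProbabilityMeasure_map (by fun_prop)

theorem integral_finiteLevyLaw (F : E →ᵇ ℝ) :
    ∫ x, F x ∂(finiteLevyLaw γ ρ) =
      ∫ x, F (x + (γ - ∫ u in Metric.closedBall 0 1, u ∂ρ)) ∂(compoundPoisson ρ) := by
  rw [finiteLevyLaw, integral_map (by fun_prop) F.continuous.aestronglyMeasurable]

/-- For a finite measure the compensator is integrable on its own, so it separates from the exponent
and becomes the deterministic shift in `finiteLevyLaw`. -/
theorem charFun_finiteLevyLaw (t : E) :
    charFun (finiteLevyLaw γ ρ) t = Complex.exp (levyExponent γ ρ t) := by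
  rw [finiteLevyLaw, charFun_map_add_const, charFun_compoundPoisson, ← Complex.exp_add]
  congr 1
  have hi1 : Integrable (fun u : E => Complex.exp (Complex.I * ((inner ℝ t u : ℝ) : ℂ))) ρ := by
    refine Integrable.of_bound (C := 1) (by fun_prop) (Filter.Eventually.of_forall fun x => ?_)
    rw [mul_comm, Complex.norm_exp_ofReal_mul_I]
  have hid : IntegrableOn (fun u : E => u) (Metric.closedBall 0 1) ρ := by
    refine Measure.integrableOn_of_bounded (M := 1) (measure_ne_top _ _) (by fun_prop) ?_
    filter_upwards [ae_restrict_mem measurableSet_closedBall] with u hu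
    simpa using hu
  have hinner : ∫ u in Metric.closedBall 0 1, inner ℝ t u ∂ρ =
      inner ℝ t (∫ u in Metric.closedBall 0 1, u ∂ρ) := integral_inner hid t
  have hi2 : IntegrableOn (fun u : E => Complex.I * ((inner ℝ t u : ℝ) : ℂ))
      (Metric.closedBall 0 1) ρ := ((hid.const_inner t).ofReal).const_mul _
  have hite : (fun u : E => if ‖u‖ ≤ 1 then Complex.I * ((inner ℝ t u : ℝ) : ℂ) else 0) =
      (Metric.closedBall 0 1).indicator fun u : E => Complex.I * ((inner ℝ t u : ℝ) : ℂ) := by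
    ext u
    simp [indicator]
  have hi3 : Integrable (fun u : E => if ‖u‖ ≤ 1 then Complex.I * ((inner ℝ t u : ℝ) : ℂ) else 0)
      ρ := by
    rw [hite, integrable_indicator_iff measurableSet_closedBall]
    exact hi2
  have hi4 : Integrable (fun u : E => Complex.exp (Complex.I * ((inner ℝ t u : ℝ) : ℂ)) - 1) ρ :=
    hi1.sub (integrable_const _)
  rw [levyExponent, integral_sub hi4 hi3, integral_sub hi1 (integrable_const _), hite,
    integral_indicator measurableSet_closedBall, integral_const_mul, integral_complex_ofReal, hinner,
    charFun_apply]
  have : ∀ u : E, Complex.exp (inner ℝ u t * Complex.I) =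
      Complex.exp (Complex.I * ((inner ℝ t u : ℝ) : ℂ)) := fun u => by
    rw [mul_comm, real_inner_comm]
  rw [integral_congr_ae (Filter.Eventually.of_forall this), inner_sub_left,
    real_inner_comm t, real_inner_comm t]
  simp
  ring

end LevyLaw

/-! ### Weak approximation and the Laplace transform bound. -/

section Approx

variable {E : Type*} [NormedAddCommGroup E] [InnerProductSpace ℝ E] [FiniteDimensional ℝ E]
  [MeasurableSpace E] [BorelSpace E] [SecondCountableTopology E]

/-- Lévy's continuity theorem: the exponents of the truncated measures converge pointwise, so the
laws converge weakly. -/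
theorem IsIDLaw.tendsto_integral {μ ν : Measure E} {γ : E} [IsProbabilityMeasure μ]
    (h : IsIDLaw μ γ ν) (F : E →ᵇ ℝ) :
    Filter.Tendsto (fun n => ∫ x, F x ∂(finiteLevyLaw γ (ν.restrict (jumpsAbove E n))))
      Filter.atTop (𝓝 (∫ x, F x ∂μ)) := by
  have hfin := h.levy.isFiniteMeasure_restrict
  let μs : ℕ → ProbabilityMeasure E := fun n =>
    ⟨finiteLevyLaw γ (ν.restrict (jumpsAbove E n)), inferInstance⟩
  let μ' : ProbabilityMeasure E := ⟨μ, inferInstance⟩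
  have ht : Filter.Tendsto μs Filter.atTop (𝓝 μ') := by
    refine ProbabilityMeasure.tendsto_of_tendsto_charFun fun t => ?_
    change Filter.Tendsto
      (fun n => charFun (finiteLevyLaw γ (ν.restrict (jumpsAbove E n))) t) _ (𝓝 (charFun μ t))
    simp only [charFun_finiteLevyLaw, h.charFun_eq]
    exact (Complex.continuous_exp.tendsto _).comp (h.levy.tendsto_levyExponent γ t)
  exact ProbabilityMeasure.tendsto_iff_forall_integral_tendsto.1 ht F

/-- The function `x ↦ exp (r * f x)`. -/
noncomputable def expMulFun (r : ℝ) (f : E →ᵇ ℝ) : E →ᵇ ℝ :=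
  BoundedContinuousFunction.ofNormedAddCommGroup (fun x => Real.exp (r * f x))
    (by fun_prop) (Real.exp (|r| * ‖f‖)) (fun x => by
      rw [Real.norm_eq_abs, Real.abs_exp, Real.exp_le_exp]
      refine (le_abs_self _).trans ?_
      rw [abs_mul]
      gcongr
      exact f.norm_coe_le_norm x)

theorem finiteLevyLaw_cov_le (γ : E) (ρ : Measure E) [IsFiniteMeasure ρ] (f g : E →ᵇ ℝ) (c : ℝ)
    (H : ∀ y z, ∫ u, (f (y + u) - f y) * (g (z + u) - g z) ∂ρ ≤ c * g z) :
    ∫ x, f x * g x ∂(finiteLevyLaw γ ρ) -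
      (∫ x, f x ∂(finiteLevyLaw γ ρ)) * ∫ x, g x ∂(finiteLevyLaw γ ρ) ≤
      c * ∫ x, g x ∂(finiteLevyLaw γ ρ) := by
  set a := γ - ∫ u in Metric.closedBall 0 1, u ∂ρ
  have h := compoundPoisson_cov_le ρ (pullbackOp ⟨fun x => x + a, by fun_prop⟩ f)
    (pullbackOp ⟨fun x => x + a, by fun_prop⟩ g) c (fun y z => by
      simpa [add_right_comm] using H (y + a) (z + a))
  have hfg := integral_finiteLevyLaw γ ρ (f * g)
  simp only [BoundedContinuousFunction.coe_mul, Pi.mul_apply] at hfg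
  rw [integral_finiteLevyLaw, integral_finiteLevyLaw, hfg]
  exact h

/-- Differential inequality argument for Laplace transforms. -/
theorem laplace_le_of_cov_le (π : Measure E) [IsProbabilityMeasure π] (f : E →ᵇ ℝ) {t : ℝ}
    (ht : 0 ≤ t) (c : ℝ → ℝ) (hc : ContinuousOn c (Icc 0 t))
    (H : ∀ r ∈ Icc 0 t, ∫ x, f x * Real.exp (r * f x) ∂π -
      (∫ x, f x ∂π) * ∫ x, Real.exp (r * f x) ∂π ≤ c r * ∫ x, Real.exp (r * f x) ∂π) :
    ∫ x, Real.exp (t * f x) ∂π ≤ Real.exp (t * ∫ x, f x ∂π + ∫ r in (0 : ℝ)..t, c r) := by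
  set m := ∫ x, f x ∂π
  -- A continuous extension of `c` to the whole line, so that its primitive is differentiable at the
  -- endpoints as well.
  set c' : ℝ → ℝ := IccExtend ht ((Icc 0 t).domRestrict c)
  have hc' : Continuous c' := (continuousOn_iff_continuous_domRestrict.1 hc).Icc_extend'
  have hcc : ∀ r ∈ Icc 0 t, c' r = c r := fun r hr => by
    simp only [c', IccExtend_of_mem ht _ hr, domRestrict_apply]
  have hint : ∫ r in (0 : ℝ)..t, c r = ∫ r in (0 : ℝ)..t, c' r :=
    intervalIntegral.integral_congr fun r hr => (hcc r (by rwa [uIcc_of_le ht] at hr)).symm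
  have hset : integrableExpSet f π = univ := by
    ext r
    simp only [integrableExpSet, mem_ofPred_eq, mem_univ, iff_true]
    exact (expMulFun r f).integrable π
  have hderiv : ∀ r, HasDerivAt (fun r => mgf f π r * Real.exp (-(r * m + ∫ s in (0 : ℝ)..r, c' s)))
      ((∫ x, f x * Real.exp (r * f x) ∂π) * Real.exp (-(r * m + ∫ s in (0 : ℝ)..r, c' s)) +
        mgf f π r * (Real.exp (-(r * m + ∫ s in (0 : ℝ)..r, c' s)) * -(m + c' r))) r := by
    intro r
    have h1 : HasDerivAt (mgf f π) (∫ x, f x * Real.exp (r * f x) ∂π) r :=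
      hasDerivAt_mgf (by simp [hset])
    have h2 : HasDerivAt (fun r => ∫ s in (0 : ℝ)..r, c' s) (c' r) r :=
      (hc'.integral_hasStrictDerivAt 0 r).hasDerivAt
    have h3 : HasDerivAt (fun r => r * m + ∫ s in (0 : ℝ)..r, c' s) (m + c' r) r := by
      have h0 : HasDerivAt (fun r => r * m) m r := by
        simpa using (hasDerivAt_id r).mul_const m
      exact h0.add h2
    exact h1.mul h3.neg.exp
  -- The hypothesis is the differential inequality `mgf' ≤ (m + c) mgf`; multiplying by the
  -- integrating factor makes the product nonincreasing.
  have hanti : AntitoneOn (fun r => mgf f π r * Real.exp (-(r * m + ∫ s in (0 : ℝ)..r, c' s)))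
      (Icc 0 t) := by
    refine antitoneOn_of_deriv_nonpos (convex_Icc 0 t)
      (fun r _ => (hderiv r).continuousAt.continuousWithinAt)
      (fun r _ => (hderiv r).differentiableAt.differentiableWithinAt) fun r hr => ?_
    rw [interior_Icc] at hr
    have hr' := Ioo_subset_Icc_self hr
    rw [(hderiv r).deriv]
    have h1 := H r hr'
    rw [← hcc r hr'] at h1
    have h2 : ∫ x, Real.exp (r * f x) ∂π = mgf f π r := rfl
    rw [h2] at h1
    have h3 := Real.exp_pos (-(r * m + ∫ s in (0 : ℝ)..r, c' s))
    nlinarith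
  have h := hanti (left_mem_Icc.2 ht) (right_mem_Icc.2 ht) ht
  simp only [mgf_zero, zero_mul, intervalIntegral.integral_same, add_zero, neg_zero, Real.exp_zero,
    mul_one] at h
  rw [Real.exp_neg, ← div_eq_mul_inv, div_le_one (Real.exp_pos _)] at h
  rw [hint]
  exact h

/-- A bound on Laplace transforms under an infinitely divisible law. -/
theorem IsIDLaw.laplace_le {μ ν : Measure E} {γ : E} [IsProbabilityMeasure μ]
    (h : IsIDLaw μ γ ν) (f : E →ᵇ ℝ) {t : ℝ} (ht : 0 ≤ t) (c : ℝ → ℝ)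
    (hc : ContinuousOn c (Icc 0 t))
    (H : ∀ n, ∀ r ∈ Icc 0 t, ∀ y z, ∫ u in jumpsAbove E n, (f (y + u) - f y) *
      (Real.exp (r * f (z + u)) - Real.exp (r * f z)) ∂ν ≤ c r * Real.exp (r * f z)) :
    ∫ x, Real.exp (t * f x) ∂μ ≤ Real.exp (t * ∫ x, f x ∂μ + ∫ r in (0 : ℝ)..t, c r) := by
  have hfin := h.levy.isFiniteMeasure_restrict
  refine le_of_tendsto_of_tendsto' (h.tendsto_integral (expMulFun t f))
    ((Real.continuous_exp.tendsto _).comp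
      (((h.tendsto_integral f).const_mul t).add_const (∫ r in (0 : ℝ)..t, c r))) fun n => ?_
  exact laplace_le_of_cov_le _ f ht c hc fun r hr =>
    finiteLevyLaw_cov_le γ (ν.restrict (jumpsAbove E n)) f (expMulFun r f) (c r) (H n r hr)

end Approx

/-! ### From exponential moments of the law to those of the large jumps. -/

section Moments

variable {E : Type*} [NormedAddCommGroup E] [InnerProductSpace ℝ E] [FiniteDimensional ℝ E]
  [MeasurableSpace E] [BorelSpace E] [SecondCountableTopology E]

/-- Existence of the infinitely divisible law with given Lévy measure. -/
theorem IsLevyMeasure.exists_charFun_eq {ν : Measure E} (h : IsLevyMeasure ν) (γ : E) :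
    ∃ V : ProbabilityMeasure E, ∀ t, charFun (V : Measure E) t =
      Complex.exp (levyExponent γ ν t) := by
  have hfin := h.isFiniteMeasure_restrict
  let V : ℕ → ProbabilityMeasure E := fun n =>
    ⟨finiteLevyLaw γ (ν.restrict (jumpsAbove E n)), inferInstance⟩
  have hlim : ∀ t, Filter.Tendsto (fun n => charFun (V n : Measure E) t) Filter.atTop
      (𝓝 (Complex.exp (levyExponent γ ν t))) := fun t => by
    change Filter.Tendsto
      (fun n => charFun (finiteLevyLaw γ (ν.restrict (jumpsAbove E n))) t) _ _
    simp only [charFun_finiteLevyLaw]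
    exact (Complex.continuous_exp.tendsto _).comp (h.tendsto_levyExponent γ t)
  have htight : IsTightMeasureSet (range fun n => (V n : Measure E)) :=
    isTightMeasureSet_of_tendsto_charFun
      (Complex.continuous_exp.continuousAt.comp (h.continuousAt_levyExponent γ 0)) hlim
  have hcompact : IsCompact (closure (range V)) := by
    refine isCompact_closure_of_isTightMeasureSet ?_
    convert htight using 1
    ext m
    simp
  -- Prokhorov's theorem gives a limit along an ultrafilter finer than `atTop`; no subsequence is
  -- needed, since the full limit of the characteristic functions identifies it.
  obtain ⟨W, -, hW⟩ := hcompact.ultrafilter_le_nhds ((Filter.hyperfilter ℕ).map V)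
    (Filter.le_principal_iff.2 (Filter.mem_map.2 (Filter.univ_mem' fun n =>
      subset_closure (mem_range_self n))))
  refine ⟨W, fun t => ?_⟩
  have hW' : Filter.Tendsto V (Filter.hyperfilter ℕ : Filter ℕ) (𝓝 W) := hW
  rw [ProbabilityMeasure.tendsto_iff_forall_integral_rclike_tendsto ℂ] at hW'
  have h1 := hW' (BoundedContinuousFunction.innerProbChar t)
  simp only [← charFun_eq_integral_innerProbChar] at h1
  exact tendsto_nhds_unique h1
    ((hlim t).mono_left (Nat.hyperfilter_le_atTop))

/-- This is the contribution of paths with exactly one jump. -/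
theorem smul_le_compoundPoisson (ρ : Measure E) [IsFiniteMeasure ρ] :
    ENNReal.ofReal (Real.exp (-ρ.real univ)) • ρ ≤ compoundPoisson ρ := by
  have h := Measure.le_sum (fun n : ℕ =>
    ENNReal.ofReal (Real.exp (-ρ.real univ) * (n.factorial : ℝ)⁻¹) • convPow ρ n) 1
  simpa [convPow, compoundPoisson] using h

/-- Splitting off the jumps of size larger than one. -/
theorem IsIDLaw.exists_conv {μ ν : Measure E} {γ : E} [IsProbabilityMeasure μ]
    (h : IsIDLaw μ γ ν) : ∃ V : ProbabilityMeasure E,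
      μ = (compoundPoisson (ν.restrict (jumpsAbove E 0))).conv V := by
  have hfin := h.levy.isFiniteMeasure_restrict 0
  set A := jumpsAbove E 0 with hA
  obtain ⟨V, hV⟩ := (h.levy.restrict Aᶜ).exists_charFun_eq γ
  refine ⟨V, Measure.ext_of_charFun (funext fun t => ?_)⟩
  rw [charFun_conv, charFun_compoundPoisson, hV, h.charFun_eq, ← Complex.exp_add]
  congr 1
  have hi := h.levy.integrable_levyKernel t
  rw [levyExponent_eq, levyExponent_eq,
    ← integral_add_compl (measurableSet_jumpsAbove (E := E) 0) hi]
  -- The threshold of `jumpsAbove E 0` is `1`, the cutoff of the compensator, so large jumps carry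
  -- no compensation.
  have h1 : ∫ u in A, levyKernel t u ∂ν =
      ∫ u in A, (Complex.exp (inner ℝ u t * Complex.I) - 1) ∂ν := by
    refine setIntegral_congr_fun (measurableSet_jumpsAbove 0) fun u hu => ?_
    have hu' : ¬ ‖u‖ ≤ 1 := by simpa [A, jumpsAbove] using hu
    simp only [levyKernel, if_neg hu', sub_zero]
    rw [mul_comm, real_inner_comm]
  have h2 : Integrable (fun u : E => Complex.exp (inner ℝ u t * Complex.I)) (ν.restrict A) := by
    refine Integrable.of_bound (C := 1) (by fun_prop) (Filter.Eventually.of_forall fun x => ?_)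
    rw [Complex.norm_exp_ofReal_mul_I]
  rw [h1, integral_sub h2 (integrable_const _), ← charFun_apply]
  simp
  ring

/-- Write the law as that of `U + V` with `U` compound Poisson with jumps larger than `1` and `V`
independent. Then `e^{s q(U+V)} ≥ e^{s q(U)} e^{-s‖V‖}`, and the law of `U` dominates a multiple of
its jump measure. -/
theorem IsIDLaw.integrableOn_exp {μ ν : Measure E} {γ : E} [IsProbabilityMeasure μ]
    (h : IsIDLaw μ γ ν) {q : E → ℝ} (hq : Continuous q) (hq' : ∀ u v, q u ≤ q (u + v) + ‖v‖)
    {s : ℝ} (hs : 0 ≤ s) (hint : Integrable (fun x => Real.exp (s * q x)) μ) :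
    IntegrableOn (fun u => Real.exp (s * q u)) (jumpsAbove E 0) ν := by
  have hfin := h.levy.isFiniteMeasure_restrict 0
  obtain ⟨V, hV⟩ := h.exists_conv
  set a := ν.restrict (jumpsAbove E 0)
  refine ⟨by fun_prop, ?_⟩
  rw [hasFiniteIntegral_iff_ofReal (Filter.Eventually.of_forall fun u => (Real.exp_pos _).le)]
  have h1 := hint.2
  rw [hasFiniteIntegral_iff_ofReal (Filter.Eventually.of_forall fun u => (Real.exp_pos _).le),
    hV, Measure.lintegral_conv (by fun_prop)] at h1
  have h2 := (lintegral_mono' (smul_le_compoundPoisson a) (le_refl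
    (fun u => ∫⁻ v, ENNReal.ofReal (Real.exp (s * q (u + v))) ∂(V : Measure E)))).trans_lt h1
  have h3 : ∀ u, ENNReal.ofReal (Real.exp (s * q u)) *
      (∫⁻ v, ENNReal.ofReal (Real.exp (-(s * ‖v‖))) ∂(V : Measure E)) ≤
      ∫⁻ v, ENNReal.ofReal (Real.exp (s * q (u + v))) ∂(V : Measure E) := by
    intro u
    rw [← lintegral_const_mul _ (by fun_prop)]
    refine lintegral_mono fun v => ?_
    rw [← ENNReal.ofReal_mul (Real.exp_pos _).le, ← Real.exp_add]
    refine ENNReal.ofReal_le_ofReal (Real.exp_le_exp.2 ?_)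
    nlinarith [hq' u v]
  rw [lintegral_smul_measure, smul_eq_mul] at h2
  have h4 := (mul_le_mul_right (lintegral_mono (μ := a) h3) _).trans_lt h2
  rw [lintegral_mul_const _ (by fun_prop)] at h4
  -- Dividing by this factor is legitimate because it is nonzero; no moment of `V` is required.
  have h5 : (∫⁻ v, ENNReal.ofReal (Real.exp (-(s * ‖v‖))) ∂(V : Measure E)) ≠ 0 := by
    rw [Ne, lintegral_eq_zero_iff (by fun_prop)]
    intro h0
    have : ∀ᵐ v ∂(V : Measure E), False := by
      filter_upwards [h0] with v hv
      simp [not_le.2 (Real.exp_pos _)] at hv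
    exact IsProbabilityMeasure.ne_zero (V : Measure E) (by simpa using this)
  by_contra htop
  rw [not_lt, top_le_iff] at htop
  change ∫⁻ u, ENNReal.ofReal (Real.exp (s * q u)) ∂a = ⊤ at htop
  rw [htop, ENNReal.top_mul h5, ENNReal.mul_top] at h4
  · exact lt_irrefl _ h4
  · simp [Real.exp_pos]

end Moments

/-! ### The norm with an added coordinate and its increments along the axes. -/

section EllNorm

/-- The `ℓ^p` norm of the vector `(x, b)`. -/
noncomputable def shiftNorm (p b : ℝ) {d : ℕ} (x : EuclideanSpace ℝ (Fin d)) : ℝ :=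
  (∑ k, |x k| ^ p + b ^ p) ^ (1 / p)

variable {d : ℕ} {p b : ℝ}

theorem ellNorm_eq (hp : 0 < p) (x : EuclideanSpace ℝ (Fin d)) :
    ellNorm p x = (∑ k, |x k| ^ p) ^ (1 / p) := by
  have h : (ENNReal.ofReal p).toReal = p := ENNReal.toReal_ofReal hp.le
  rw [ellNorm, PiLp.norm_eq_sum (by rw [h]; exact hp), h]
  rfl

theorem ellNorm_nonneg (hp : 0 < p) (x : EuclideanSpace ℝ (Fin d)) : 0 ≤ ellNorm p x := by
  rw [ellNorm_eq hp]; positivity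

theorem ellNorm_le_norm (hp : 2 ≤ p) (x : EuclideanSpace ℝ (Fin d)) : ellNorm p x ≤ ‖x‖ := by
  have hp0 : 0 < p := by linarith
  rw [ellNorm_eq hp0, one_div, Real.rpow_inv_le_iff_of_pos (by positivity) (norm_nonneg _) hp0]
  have hk : ∀ k, |x k| ≤ ‖x‖ := fun k => PiLp.norm_apply_le x k
  have h1 : ∀ k, |x k| ^ p ≤ |x k| ^ 2 * ‖x‖ ^ (p - 2) := fun k => by
    rcases eq_or_lt_of_le (abs_nonneg (x k)) with h | h
    · rw [← h, Real.zero_rpow hp0.ne']; simp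
    · have : |x k| ^ p = |x k| ^ (2 : ℕ) * |x k| ^ (p - 2) := by
        rw [← Real.rpow_natCast, ← Real.rpow_add h]; congr 1; push_cast; ring
      rw [this]
      gcongr
      exact hk k
  refine (Finset.sum_le_sum fun k _ => h1 k).trans ?_
  rw [← Finset.sum_mul]
  have h2 : ∑ k, |x k| ^ 2 = ‖x‖ ^ 2 := by
    rw [EuclideanSpace.norm_sq_eq]; rfl
  rw [h2]
  rcases eq_or_lt_of_le (norm_nonneg x) with h | h
  · rw [← h]; simp [Real.zero_rpow hp0.ne']
  · rw [← Real.rpow_natCast, ← Real.rpow_add h]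
    apply le_of_eq; congr 1; push_cast; ring

theorem continuous_ellNorm (hp : 0 < p) :
    Continuous (ellNorm p : EuclideanSpace ℝ (Fin d) → ℝ) := by
  have : (ellNorm p : EuclideanSpace ℝ (Fin d) → ℝ) =
      fun x => (∑ k, |x k| ^ p) ^ (1 / p) := funext (ellNorm_eq hp)
  rw [this]
  refine Continuous.rpow_const (continuous_finsetSum _ fun k _ =>
    Continuous.rpow_const (by fun_prop) fun _ => Or.inr hp.le) fun _ => Or.inr (by positivity)

theorem continuous_shiftNorm (hp : 0 < p) :
    Continuous (shiftNorm p b : EuclideanSpace ℝ (Fin d) → ℝ) := by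
  refine Continuous.rpow_const ((continuous_finsetSum _ fun k _ =>
    Continuous.rpow_const (by fun_prop) fun _ => Or.inr hp.le).add continuous_const)
    fun _ => Or.inr (by positivity)

theorem ellNorm_le_shiftNorm (hp : 0 < p) (hb : 0 ≤ b) (x : EuclideanSpace ℝ (Fin d)) :
    ellNorm p x ≤ shiftNorm p b x := by
  rw [ellNorm_eq hp, shiftNorm]
  gcongr
  have := Real.rpow_nonneg hb p
  linarith

theorem shiftNorm_le_ellNorm_add (hp : 1 ≤ p) (hb : 0 ≤ b) (x : EuclideanSpace ℝ (Fin d)) :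
    shiftNorm p b x ≤ ellNorm p x + b := by
  have hp0 : 0 < p := by linarith
  rw [ellNorm_eq hp0, shiftNorm]
  refine (Real.rpow_add_le_add_rpow (by positivity) (by positivity) (by positivity)
    (by rw [div_le_one hp0]; exact hp)).trans_eq ?_
  rw [← Real.rpow_mul hb, mul_one_div_cancel hp0.ne', Real.rpow_one]

theorem le_shiftNorm (hp : 0 < p) (hb : 0 ≤ b) (x : EuclideanSpace ℝ (Fin d)) :
    b ≤ shiftNorm p b x := by
  have h : b = (b ^ p) ^ (1 / p) := by
    rw [← Real.rpow_mul hb, mul_one_div_cancel hp.ne', Real.rpow_one]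
  conv_lhs => rw [h]
  rw [shiftNorm]
  gcongr
  have : 0 ≤ ∑ k, |x k| ^ p := by positivity
  linarith

theorem shiftNorm_rpow (hp : 0 < p) (hb : 0 ≤ b) (x : EuclideanSpace ℝ (Fin d)) :
    shiftNorm p b x ^ p = ∑ k, |x k| ^ p + b ^ p := by
  rw [shiftNorm, ← Real.rpow_mul (by positivity), one_div_mul_cancel hp.ne', Real.rpow_one]

theorem abs_apply_le_shiftNorm (hp : 0 < p) (hb : 0 ≤ b) (x : EuclideanSpace ℝ (Fin d))
    (k : Fin d) : |x k| ≤ shiftNorm p b x := by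
  have h0 : 0 ≤ shiftNorm p b x := hb.trans (le_shiftNorm hp hb x)
  rw [← Real.rpow_le_rpow_iff (abs_nonneg _) h0 hp, shiftNorm_rpow hp hb]
  have h1 := Finset.single_le_sum (f := fun k => |x k| ^ p) (fun k _ => by positivity)
    (Finset.mem_univ k)
  have h2 : 0 ≤ b ^ p := by positivity
  simp only at h1
  linarith

theorem shiftNorm_add_single_rpow_sub (hp : 0 < p) (hb : 0 ≤ b) (x : EuclideanSpace ℝ (Fin d))
    (k : Fin d) (u : ℝ) :
    shiftNorm p b (x + EuclideanSpace.single k u) ^ p - shiftNorm p b x ^ p =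
      |x k + u| ^ p - |x k| ^ p := by
  rw [shiftNorm_rpow hp hb, shiftNorm_rpow hp hb, add_sub_add_right_eq_sub,
    ← Finset.sum_sub_distrib, Finset.sum_eq_single k]
  · simp
  · intro j _ hj
    simp [hj]
  · simp

theorem rpow_sub_rpow_le (hp : 1 ≤ p) {a c : ℝ} (hc : 0 ≤ c) (hca : c ≤ a) :
    a ^ p - c ^ p ≤ p * (a - c) * a ^ (p - 1) := by
  rcases eq_or_lt_of_le (hc.trans hca) with h | h
  · have : c = a := by linarith
    rw [this]; simp
  -- Bernoulli's inequality at `c / a - 1`: the graph of `y ↦ y^p` lies above its tangent at `a`.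
  have h1 := one_add_mul_self_le_rpow_one_add (s := c / a - 1) (p := p)
    (by have := div_nonneg hc h.le; linarith) hp
  rw [add_sub_cancel, Real.div_rpow hc h.le, le_div_iff₀ (by positivity)] at h1
  have h2 : a ^ p = a ^ (p - 1) * a := by
    rw [← Real.rpow_add_one h.ne', sub_add_cancel]
  have h3 : (1 + p * (c / a - 1)) * (a ^ (p - 1) * a) =
      a ^ (p - 1) * a + p * (c - a) * a ^ (p - 1) := by
    field_simp
  rw [h2, h3] at h1
  rw [h2]
  linarith

theorem abs_rpow_sub_rpow_le (hp : 1 ≤ p) (x u : ℝ) :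
    |(|x + u| ^ p - |x| ^ p)| ≤ p * |u| * (|x| + |u|) ^ (p - 1) := by
  have h1 : |x + u| ≤ |x| + |u| := abs_add_le x u
  have h2 : |x| ≤ |x + u| + |u| := by
    have := abs_add_le (x + u) (-u)
    rwa [add_neg_cancel_right, abs_neg] at this
  have hu := abs_nonneg u
  have hx := abs_nonneg x
  rw [abs_le']
  constructor
  · rcases le_total |x| |x + u| with h | h
    · refine (rpow_sub_rpow_le hp hx h).trans ?_
      gcongr
      linarith
    · have : |x + u| ^ p ≤ |x| ^ p := by gcongr
      have h3 : 0 ≤ p * |u| * (|x| + |u|) ^ (p - 1) := by positivity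
      linarith
  · rw [neg_sub]
    rcases le_total |x + u| |x| with h | h
    · refine (rpow_sub_rpow_le hp (abs_nonneg _) h).trans ?_
      gcongr
      · linarith
      · linarith
    · have : |x| ^ p ≤ |x + u| ^ p := by gcongr
      have h3 : 0 ≤ p * |u| * (|x| + |u|) ^ (p - 1) := by positivity
      linarith

/-- Holds because `y ↦ y^(p-1)` is nondecreasing. The weight sits at the base point `c` whether `a`
is larger or smaller, so one common power can be divided out after summing over the axes. -/
theorem abs_sub_mul_rpow_le (hp : 1 ≤ p) {a c : ℝ} (ha : 0 ≤ a) (hc : 0 < c) :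
    |a - c| * c ^ (p - 1) ≤ |a ^ p - c ^ p| := by
  have h1 : c ^ p = c * c ^ (p - 1) := by
    rw [mul_comm, ← Real.rpow_add_one hc.ne', sub_add_cancel]
  have h2 : a ^ p = a * a ^ (p - 1) := by
    rcases eq_or_lt_of_le ha with h | h
    · rw [← h, Real.zero_rpow (by linarith), zero_mul]
    · rw [mul_comm, ← Real.rpow_add_one h.ne', sub_add_cancel]
  rcases le_total c a with h | h
  · have h3 : c ^ (p - 1) ≤ a ^ (p - 1) := by gcongr
    rw [abs_of_nonneg (by linarith)]
    refine le_trans ?_ (le_abs_self _)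
    rw [h1, h2]
    nlinarith
  · have h3 : a ^ (p - 1) ≤ c ^ (p - 1) := by gcongr
    rw [abs_of_nonpos (by linarith)]
    refine le_trans ?_ (neg_le_abs _)
    rw [h1, h2]
    nlinarith

theorem shiftNorm_add_le (hp : 1 ≤ p) (hb : 0 ≤ b) (x v : EuclideanSpace ℝ (Fin d)) :
    shiftNorm p b (x + v) ≤ shiftNorm p b x + ellNorm p v := by
  have hp0 : 0 < p := by linarith
  -- Minkowski's inequality in dimension `d + 1`; the index `none` carries the extra coordinate,
  -- equal to `b` in one vector and `0` in the other.
  have h := Real.Lp_add_le (Finset.univ : Finset (Option (Fin d)))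
    (fun o => o.elim b fun k => x k) (fun o => o.elim 0 fun k => v k) hp
  simp only [Fintype.sum_option, Option.elim_none, Option.elim_some, add_zero, abs_zero,
    Real.zero_rpow hp0.ne', zero_add, abs_of_nonneg hb] at h
  rw [ellNorm_eq hp0, shiftNorm, shiftNorm, add_comm _ (b ^ p), add_comm _ (b ^ p)]
  simpa using h

theorem ellNorm_neg (hp : 0 < p) (v : EuclideanSpace ℝ (Fin d)) :
    ellNorm p (-v) = ellNorm p v := by
  rw [ellNorm_eq hp, ellNorm_eq hp]
  simp

theorem ellNorm_single (hp : 0 < p) (k : Fin d) (u : ℝ) :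
    ellNorm p (EuclideanSpace.single k u) = |u| := by
  rw [ellNorm_eq hp, Finset.sum_eq_single k]
  · rw [PiLp.single_apply, if_pos rfl, ← Real.rpow_mul (abs_nonneg _),
      mul_one_div_cancel hp.ne', Real.rpow_one]
  · intro j _ hj
    simp [hj, hp.ne']
  · simp

theorem abs_shiftNorm_add_single_sub_le (hp : 1 ≤ p) (hb : 0 < b)
    (x : EuclideanSpace ℝ (Fin d)) (k : Fin d) (u : ℝ) :
    |shiftNorm p b (x + EuclideanSpace.single k u) - shiftNorm p b x| ≤ |u| := by
  have hp0 : 0 < p := by linarith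
  have h1 := shiftNorm_add_le hp hb.le x (EuclideanSpace.single k u)
  have h2 := shiftNorm_add_le hp hb.le (x + EuclideanSpace.single k u) (-EuclideanSpace.single k u)
  rw [add_neg_cancel_right, ellNorm_neg hp0] at h2
  rw [ellNorm_single hp0] at h1 h2
  rw [abs_le]
  constructor <;> linarith

/-- Only the `k`-th term of the `p`-th power changes along `e_k`, so each increment times `N^(p-1)`
is at most `p|u|(|x_k| + |u|)^(p-1)`. Squaring produces the exponent `q = 2p - 2`, and Minkowski's
inequality in `ℓ^q` produces `d^(1/q)`. -/
theorem sum_sq_shiftNorm_sub_le (hp : 2 ≤ p) (hb : 0 < b)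
    (x : EuclideanSpace ℝ (Fin d)) (u : ℝ) :
    ∑ k, (shiftNorm p b (x + EuclideanSpace.single k u) - shiftNorm p b x) ^ 2 ≤
      p ^ 2 * |u| ^ 2 * (1 + |u| * (d : ℝ) ^ (1 / (2 * p - 2)) / b) ^ (2 * p - 2) := by
  have hp0 : 0 < p := by linarith
  have hp1 : 1 ≤ p := by linarith
  set q := 2 * p - 2 with hq
  have hq1 : 1 ≤ q := by linarith
  set N := shiftNorm p b x
  have hbN : b ≤ N := le_shiftNorm hp0 hb.le x
  have hN : 0 < N := hb.trans_le hbN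
  have hsq : ∀ y : ℝ, 0 ≤ y → (y ^ (p - 1)) ^ 2 = y ^ q := fun y hy => by
    rw [← Real.rpow_natCast, ← Real.rpow_mul hy]; congr 1; push_cast; ring
  have h1 : ∀ k, (shiftNorm p b (x + EuclideanSpace.single k u) - N) ^ 2 * N ^ q ≤
      p ^ 2 * |u| ^ 2 * (|x k| + |u|) ^ q := fun k => by
    have h := (abs_sub_mul_rpow_le hp1
      (hb.le.trans (le_shiftNorm hp0 hb.le (x + EuclideanSpace.single k u))) hN).trans
      ((congrArg abs (shiftNorm_add_single_rpow_sub hp0 hb.le x k u)).trans_le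
      (abs_rpow_sub_rpow_le hp1 (x k) u))
    have h' := pow_le_pow_left₀ (by positivity) h 2
    rw [mul_pow, mul_pow, mul_pow, sq_abs, hsq N hN.le, hsq _ (by positivity)] at h'
    exact h'
  have h2 : ∑ k, (|x k| + |u|) ^ q ≤ (N + |u| * (d : ℝ) ^ (1 / q)) ^ q := by
    have h3 := Real.Lp_add_le_of_nonneg (s := Finset.univ) (f := fun k => |x k|)
      (g := fun _ : Fin d => |u|) hq1 (fun _ _ => abs_nonneg _) (fun _ _ => abs_nonneg _)
    have h4 : (∑ k, |x k| ^ q) ^ (1 / q) ≤ N := by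
      rw [one_div, Real.rpow_inv_le_iff_of_pos (by positivity) hN.le (by linarith)]
      -- The `ℓ^q` norm is dominated by the `ℓ^p` norm since `q = p + (p - 2)` with `p ≥ 2`; this is
      -- where `p ≥ 2` matters.
      have h5 : ∀ k, |x k| ^ q ≤ |x k| ^ p * N ^ (p - 2) := fun k => by
        rcases eq_or_lt_of_le (abs_nonneg (x k)) with h | h
        · rw [← h, Real.zero_rpow (by linarith), Real.zero_rpow hp0.ne']; simp
        · have : |x k| ^ q = |x k| ^ p * |x k| ^ (p - 2) := by
            rw [← Real.rpow_add h]; congr 1; rw [hq]; ring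
          rw [this]
          gcongr
          exact abs_apply_le_shiftNorm hp0 hb.le x k
      refine (Finset.sum_le_sum fun k _ => h5 k).trans ?_
      rw [← Finset.sum_mul]
      have h6 : ∑ k, |x k| ^ p ≤ N ^ p := by
        rw [shiftNorm_rpow hp0 hb.le]
        have : 0 ≤ b ^ p := by positivity
        linarith
      calc (∑ k, |x k| ^ p) * N ^ (p - 2) ≤ N ^ p * N ^ (p - 2) := by gcongr
        _ = N ^ q := by rw [← Real.rpow_add hN]; congr 1; rw [hq]; ring
    have h7 : (∑ _k : Fin d, |u| ^ q) ^ (1 / q) = |u| * (d : ℝ) ^ (1 / q) := by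
      rw [Finset.sum_const, Finset.card_univ, Fintype.card_fin, nsmul_eq_mul,
        Real.mul_rpow (by positivity) (by positivity), ← Real.rpow_mul (abs_nonneg u),
        mul_one_div_cancel (by linarith), Real.rpow_one, mul_comm]
    rw [h7] at h3
    have h8 := h3.trans (add_le_add_left h4 _)
    rwa [one_div, Real.rpow_inv_le_iff_of_pos (by positivity) (by positivity) (by linarith),
      ← one_div] at h8
  have h9 : (∑ k, (shiftNorm p b (x + EuclideanSpace.single k u) - N) ^ 2) * N ^ q ≤
      p ^ 2 * |u| ^ 2 * (N + |u| * (d : ℝ) ^ (1 / q)) ^ q := by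
    rw [Finset.sum_mul]
    refine (Finset.sum_le_sum fun k _ => h1 k).trans ?_
    rw [← Finset.mul_sum]
    gcongr
  -- The lower bound `N ≥ b` given by the added coordinate makes the estimate uniform in `x`.
  have h10 : N + |u| * (d : ℝ) ^ (1 / q) ≤ N * (1 + |u| * (d : ℝ) ^ (1 / q) / b) := by
    have : |u| * (d : ℝ) ^ (1 / q) ≤ N * (|u| * (d : ℝ) ^ (1 / q) / b) := by
      rw [mul_div_assoc', le_div_iff₀ hb, mul_comm]
      gcongr
    linarith
  refine le_of_mul_le_mul_right (h9.trans ?_) (show 0 < N ^ q by positivity)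
  refine (mul_le_mul_of_nonneg_left (Real.rpow_le_rpow (by positivity) h10 (zero_le_one.trans hq1))
    (show 0 ≤ p ^ 2 * |u| ^ 2 by positivity)).trans_eq ?_
  rw [Real.mul_rpow hN.le (by positivity)]
  ring

end EllNorm

/-! ### Inverse of an increasing function: Young's equality and the range. -/

section Inverse

/-- The integral of the inverse of an increasing function. -/
theorem integral_inverse_of_strictMonoOn {h g : ℝ → ℝ} {T x : ℝ} (hT : 0 ≤ T)
    (hc : ContinuousOn h (Icc 0 T)) (hm : StrictMonoOn h (Icc 0 T)) (h0 : h 0 = 0) (hx : h T = x)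
    (hg : ∀ r ∈ Icc 0 T, g (h r) = r) :
    IntervalIntegrable g volume 0 x ∧ ∫ s in (0 : ℝ)..x, g s = T * x - ∫ r in (0 : ℝ)..T, h r := by
  have h0T : (0 : ℝ) ∈ Icc 0 T := left_mem_Icc.2 hT
  have hTT : T ∈ Icc 0 T := right_mem_Icc.2 hT
  have hx0 : 0 ≤ x := by rw [← h0, ← hx]; exact hm.monotoneOn h0T hTT hT
  have hsurj : ∀ s ∈ Icc 0 x, ∃ r ∈ Icc 0 T, h r = s := by
    have := intermediate_value_Icc hT hc
    rwa [h0, hx] at this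
  have hgmono : MonotoneOn g (Icc 0 x) := by
    intro s hs s' hs' hss
    obtain ⟨r, hr, rfl⟩ := hsurj s hs
    obtain ⟨r', hr', rfl⟩ := hsurj s' hs'
    rw [hg r hr, hg r' hr']
    exact (hm.le_iff_le hr hr').1 hss
  refine ⟨MonotoneOn.intervalIntegrable (by rwa [uIcc_of_le hx0]), ?_⟩
  set h' : ℝ → ℝ := IccExtend hT ((Icc 0 T).domRestrict h)
  have hc' : Continuous h' := (continuousOn_iff_continuous_domRestrict.1 hc).Icc_extend'
  have hh : ∀ r ∈ Icc 0 T, h' r = h r := fun r hr => by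
    simp only [h', IccExtend_of_mem hT _ hr, domRestrict_apply]
  -- The area of `{h(r) ≤ s}` in `[0, x] × [0, T]` is computed twice: the section at `s` has length
  -- `g(s)`, the section at `r` has length `x - h(r)`.
  set A : Set (ℝ × ℝ) := {q | h' q.2 ≤ q.1}
  have hA : MeasurableSet A := measurableSet_le (hc'.measurable.comp measurable_snd) measurable_fst
  have hint : Integrable (fun q : ℝ × ℝ => A.indicator (fun _ => (1 : ℝ)) q)
      ((volume.restrict (Ioc 0 x)).prod (volume.restrict (Ioc 0 T))) :=
    (integrable_const (1 : ℝ)).indicator hA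
  have hswap := integral_integral_swap (f := fun s r => A.indicator (fun _ => (1 : ℝ)) (s, r)) hint
  have hleft : ∫ s in Ioc 0 x, ∫ r in Ioc 0 T, A.indicator (fun _ => (1 : ℝ)) (s, r) =
      ∫ s in Ioc 0 x, g s := by
    refine setIntegral_congr_fun measurableSet_Ioc fun s hs => ?_
    obtain ⟨r, hr, hrs⟩ := hsurj s ⟨hs.1.le, hs.2⟩
    have hgs : g s = r := by rw [← hrs, hg r hr]
    have h1 : EqOn (fun r' => A.indicator (fun _ => (1 : ℝ)) (s, r'))
        ((Ioc 0 r).indicator fun _ => (1 : ℝ)) (Ioc 0 T) := by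
      intro r' hr'
      have hr'' : r' ∈ Icc 0 T := ⟨hr'.1.le, hr'.2⟩
      have : (s, r') ∈ A ↔ r' ∈ Ioc 0 r := by
        simp only [A, mem_ofPred_eq, hh r' hr'', ← hrs, hm.le_iff_le hr'' hr, mem_Ioc, hr'.1,
          true_and]
      simp only [indicator, this]
    rw [setIntegral_congr_fun measurableSet_Ioc h1, setIntegral_indicator measurableSet_Ioc,
      Ioc_inter_Ioc, hgs]
    simp [hr.1, hr.2]
  have hright : ∫ r in Ioc 0 T, ∫ s in Ioc 0 x, A.indicator (fun _ => (1 : ℝ)) (s, r) =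
      ∫ r in Ioc 0 T, (x - h r) := by
    refine setIntegral_congr_fun measurableSet_Ioc fun r hr => ?_
    have hr' : r ∈ Icc 0 T := ⟨hr.1.le, hr.2⟩
    have hpos : 0 < h r := by rw [← h0]; exact hm h0T hr' hr.1
    have hle : h r ≤ x := by rw [← hx]; exact hm.monotoneOn hr' hTT hr.2
    have h1 : EqOn (fun s => A.indicator (fun _ => (1 : ℝ)) (s, r))
        ((Ici (h r)).indicator fun _ => (1 : ℝ)) (Ioc 0 x) := by
      intro s _
      have : (s, r) ∈ A ↔ s ∈ Ici (h r) := by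
        simp only [A, mem_ofPred_eq, hh r hr', mem_Ici]
      simp only [indicator, this]
    have h2 : Ioc 0 x ∩ Ici (h r) = Icc (h r) x := by
      ext s
      simp only [mem_inter_iff, mem_Ioc, mem_Ici, mem_Icc]
      constructor
      · rintro ⟨⟨_, a⟩, b⟩; exact ⟨b, a⟩
      · rintro ⟨a, b⟩; exact ⟨⟨hpos.trans_le a, b⟩, a⟩
    rw [setIntegral_congr_fun measurableSet_Ioc h1, setIntegral_indicator measurableSet_Ici, h2]
    simp [hle]
  have hhint : IntervalIntegrable h volume 0 T :=
    ContinuousOn.intervalIntegrable (by rwa [uIcc_of_le hT])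
  rw [hleft, hright, ← intervalIntegral.integral_of_le hx0, ← intervalIntegral.integral_of_le hT,
    intervalIntegral.integral_sub intervalIntegrable_const hhint] at hswap
  rw [hswap]
  simp

end Inverse

section Image

theorem mem_icoZero {M : ENNReal} {t : ℝ} : t ∈ icoZero M ↔ 0 ≤ t ∧ ENNReal.ofReal t < M := Iff.rfl

theorem Icc_subset_icoZero {M : ENNReal} {t : ℝ} (ht : t ∈ icoZero M) : Icc 0 t ⊆ icoZero M :=
  fun _ hr => ⟨hr.1, (ENNReal.ofReal_le_ofReal hr.2).trans_lt ht.2⟩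

theorem exists_gt_mem_icoZero {M : ENNReal} {t : ℝ} (ht : t ∈ icoZero M) :
    ∃ t' ∈ icoZero M, t < t' := by
  obtain ⟨s, hs1, hs2⟩ := ENNReal.lt_iff_exists_nnreal_btwn.1 ht.2
  refine ⟨s, ⟨s.2, by simpa using hs2⟩, ?_⟩
  exact (ENNReal.ofReal_lt_coe_iff ht.1).1 hs1

/-- The supremum is not attained, since `[0, M)` has no greatest element and `h` is strictly
increasing; every smaller value is reached by the intermediate value theorem. -/
theorem image_icoZero {h : ℝ → ℝ} {M : ENNReal} (hM : 0 < M) (h0 : h 0 = 0)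
    (hm : StrictMonoOn h (icoZero M)) (hc : ∀ t ∈ icoZero M, ContinuousOn h (Icc 0 t)) :
    h '' icoZero M = icoZero (limAtEnd h M) := by
  have h0M : (0 : ℝ) ∈ icoZero M := ⟨le_rfl, by simpa using hM⟩
  ext y
  constructor
  · rintro ⟨t, ht, rfl⟩
    obtain ⟨t', ht', htt⟩ := exists_gt_mem_icoZero ht
    have hpos : 0 ≤ h t := by rw [← h0]; exact hm.monotoneOn h0M ht ht.1
    refine ⟨hpos, lt_of_lt_of_le ?_ (le_iSup₂ (f := fun t _ => ENNReal.ofReal (h t)) t' ht')⟩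
    rw [ENNReal.ofReal_lt_ofReal_iff_of_nonneg hpos]
    exact hm ht ht' htt
  · rintro ⟨hy, hy'⟩
    obtain ⟨t, ht⟩ := lt_iSup_iff.1 hy'
    obtain ⟨htM, ht⟩ := lt_iSup_iff.1 ht
    have hyt : y < h t := (ENNReal.ofReal_lt_ofReal_iff_of_nonneg hy).1 ht
    obtain ⟨r, hr, hry⟩ := intermediate_value_Icc htM.1 (hc t htM) ⟨by rw [h0]; exact hy, hyt.le⟩
    exact ⟨r, Icc_subset_icoZero htM hr, hry⟩

end Image

/-! ### Finiteness, continuity and strict monotonicity of `h`. -/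

section HFun

variable {d : ℕ} {p ε m : ℝ}

theorem hIntegrand_nonneg (hε : 0 < ε) (hm : 0 < m) {t : ℝ} (ht : 0 ≤ t)
    (u : ℝ) : 0 ≤ hIntegrand d p ε m t u := by
  have : 1 ≤ Real.exp (t * |u|) := Real.one_le_exp (by positivity)
  unfold hIntegrand
  refine mul_nonneg (by positivity) (mul_nonneg (abs_nonneg u) (by linarith))

theorem hIntegrand_mono (hε : 0 < ε) (hm : 0 < m) {t t' : ℝ} (htt : t ≤ t') (u : ℝ) :
    hIntegrand d p ε m t u ≤ hIntegrand d p ε m t' u := by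
  unfold hIntegrand
  gcongr

theorem hIntegrand_lt (hε : 0 < ε) (hm : 0 < m) {t t' : ℝ} (htt : t < t') {u : ℝ} (hu : u ≠ 0) :
    hIntegrand d p ε m t u < hIntegrand d p ε m t' u := by
  have := abs_pos.2 hu
  unfold hIntegrand
  gcongr

theorem measurable_hIntegrand (t : ℝ) : Measurable (hIntegrand d p ε m t) := by
  unfold hIntegrand
  fun_prop

theorem exists_rpow_le_exp {κ q δ : ℝ} (hκ : 0 ≤ κ) (hq : 0 < q) (hδ : 0 < δ) :
    ∃ C, 0 ≤ C ∧ ∀ y, 0 ≤ y → (1 + y * κ) ^ q * y ≤ C * Real.exp (δ * y) := by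
  -- The rate `δ` is split in halves: `(e^{ay})^q = e^{δy/2}` absorbs the power, and another
  -- `e^{δy/2}` absorbs the factor `y`.
  set a := δ / (2 * q) with ha
  have ha0 : 0 < a := by positivity
  refine ⟨(1 + κ / a) ^ q * (2 / δ), by positivity, fun y hy => ?_⟩
  have h1 : 1 + y * κ ≤ (1 + κ / a) * Real.exp (a * y) := by
    have h2 := Real.add_one_le_exp (a * y)
    calc 1 + y * κ ≤ (1 + κ / a) * (a * y + 1) := by
          have : κ / a * (a * y) = y * κ := by field_simp
          have h3 : 0 ≤ κ / a := by positivity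
          have h4 : 0 ≤ a * y := by positivity
          nlinarith
      _ ≤ _ := by gcongr
  have h2 : y ≤ 2 / δ * Real.exp (δ / 2 * y) := by
    have h3 := Real.add_one_le_exp (δ / 2 * y)
    rw [div_mul_eq_mul_div, le_div_iff₀ hδ]
    linarith
  calc (1 + y * κ) ^ q * y ≤ ((1 + κ / a) * Real.exp (a * y)) ^ q *
        (2 / δ * Real.exp (δ / 2 * y)) := by gcongr
    _ = (1 + κ / a) ^ q * (2 / δ) * Real.exp (δ * y) := by
      rw [Real.mul_rpow (by positivity) (by positivity), ← Real.exp_mul]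
      have : Real.exp (δ * y) = Real.exp (a * y * q) * Real.exp (δ / 2 * y) := by
        rw [← Real.exp_add]; congr 1; rw [ha]; field_simp; ring
      rw [this]; ring

variable {ν₁ : Measure ℝ}

/-- For large `u` the gap `s - t` absorbs the polynomial factor; for `|u| ≤ 1` the integrand is
`O(u²)`, as `e^y - 1 ≤ y e^y`. -/
theorem integrable_hIntegrand (hp : 2 ≤ p) (hε : 0 < ε) (hm : 0 < m) (hν₁ : IsLevyMeasure ν₁)
    {s t : ℝ} (ht : 0 ≤ t) (hts : t < s)
    (hs : IntegrableOn (fun u => Real.exp (s * |u|)) (jumpsAbove ℝ 0) ν₁) :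
    Integrable (hIntegrand d p ε m t) ν₁ := by
  set κ := (d : ℝ) ^ (1 / (2 * p - 2)) / (ε * m) with hκ
  have hκ0 : 0 ≤ κ := by positivity
  have hform : ∀ u, hIntegrand d p ε m t u =
      (1 + |u| * κ) ^ (2 * p - 2) * |u| * (Real.exp (t * |u|) - 1) := fun u => by
    rw [hIntegrand, hκ, mul_div_assoc, mul_assoc]
  have hmeas := (measurable_hIntegrand (d := d) (p := p) (ε := ε) (m := m) t)
  obtain ⟨C, hC0, hC⟩ := exists_rpow_le_exp hκ0 (show 0 < 2 * p - 2 by linarith)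
    (show 0 < s - t by linarith)
  have hbig : IntegrableOn (hIntegrand d p ε m t) (jumpsAbove ℝ 0) ν₁ := by
    refine (hs.const_mul C).mono' hmeas.aestronglyMeasurable
      (Filter.Eventually.of_forall fun u => ?_)
    rw [Real.norm_of_nonneg (hIntegrand_nonneg hε hm ht u), hform]
    have h1 := hC |u| (abs_nonneg u)
    have h2 : Real.exp (s * |u|) = Real.exp ((s - t) * |u|) * Real.exp (t * |u|) := by
      rw [← Real.exp_add]; congr 1; ring
    rw [h2, ← mul_assoc]
    have h3 : 1 ≤ Real.exp (t * |u|) := Real.one_le_exp (by positivity)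
    refine mul_le_mul h1 (by linarith) (by linarith) (by positivity)
  have hsmall : IntegrableOn (hIntegrand d p ε m t) (jumpsAbove ℝ 0)ᶜ ν₁ := by
    refine ((hν₁.integrable_min.integrableOn (s := (jumpsAbove ℝ 0)ᶜ)).const_mul
      ((1 + κ) ^ (2 * p - 2) * (t * Real.exp t))).mono' hmeas.aestronglyMeasurable ?_
    filter_upwards [ae_restrict_mem (measurableSet_jumpsAbove 0).compl] with u hu
    rw [Real.norm_of_nonneg (hIntegrand_nonneg hε hm ht u), hform]
    have hu1 : |u| ≤ 1 := by simpa [jumpsAbove] using hu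
    have hu0 := abs_nonneg u
    have h1 : ‖u‖ ^ 2 ≤ 1 := by rw [Real.norm_eq_abs]; nlinarith
    rw [min_eq_right h1, Real.norm_eq_abs]
    have h2 : Real.exp (t * |u|) - 1 ≤ t * |u| * Real.exp t := by
      have h3 := Real.add_one_le_exp (-(t * |u|))
      have h4 : Real.exp (t * |u|) * Real.exp (-(t * |u|)) = 1 := by
        rw [← Real.exp_add, add_neg_cancel, Real.exp_zero]
      have h5 : Real.exp (t * |u|) ≤ Real.exp t := Real.exp_le_exp.2 (by nlinarith)
      have h6 := Real.exp_pos (t * |u|)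
      have h7 : 0 ≤ t * |u| := by positivity
      nlinarith
    have h3 : 1 ≤ Real.exp (t * |u|) := Real.one_le_exp (by positivity)
    calc (1 + |u| * κ) ^ (2 * p - 2) * |u| * (Real.exp (t * |u|) - 1)
        ≤ (1 + κ) ^ (2 * p - 2) * |u| * (t * |u| * Real.exp t) := by
          have h8 : (1 + |u| * κ) ^ (2 * p - 2) ≤ (1 + κ) ^ (2 * p - 2) := by
            refine Real.rpow_le_rpow (by positivity) ?_ (by linarith)
            nlinarith
          refine mul_le_mul ?_ h2 (by linarith) (by positivity)
          gcongr
      _ = _ := by ring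
  have := hbig.union hsmall
  rwa [union_compl_self, integrableOn_univ] at this

theorem hFun_zero : hFun d p ε m ν₁ 0 = 0 := by
  simp [hFun, hIntegrand]

theorem continuousOn_hFun (hε : 0 < ε) (hm : 0 < m) {t : ℝ}
    (hi : Integrable (hIntegrand d p ε m t) ν₁) :
    ContinuousOn (hFun d p ε m ν₁) (Icc 0 t) := by
  unfold hFun
  refine ContinuousOn.mul continuousOn_const ?_
  refine continuousOn_of_dominated (bound := hIntegrand d p ε m t)
    (fun r _ => (measurable_hIntegrand r).aestronglyMeasurable)
    (fun r hr => Filter.Eventually.of_forall fun u => ?_) hi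
    (Filter.Eventually.of_forall fun u => ?_)
  · rw [Real.norm_of_nonneg (hIntegrand_nonneg hε hm hr.1 u)]
    exact hIntegrand_mono hε hm hr.2 u
  · unfold hIntegrand
    fun_prop

theorem hFun_lt (hp : 2 ≤ p) (hε : 0 < ε) (hm : 0 < m) (hν₁ : IsLevyMeasure ν₁) (h0 : ν₁ ≠ 0)
    {t t' : ℝ} (htt : t < t') (hi : Integrable (hIntegrand d p ε m t) ν₁)
    (hi' : Integrable (hIntegrand d p ε m t') ν₁) :
    hFun d p ε m ν₁ t < hFun d p ε m ν₁ t' := by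
  unfold hFun
  refine mul_lt_mul_of_pos_left ?_ (by positivity)
  rw [← sub_pos, ← integral_sub hi' hi, integral_pos_iff_support_of_nonneg
    (fun u => sub_nonneg.2 (hIntegrand_mono hε hm htt.le u)) (hi'.sub hi)]
  refine lt_of_lt_of_le ?_ (measure_mono (s := {0}ᶜ) fun u hu => ?_)
  · rw [pos_iff_ne_zero]
    intro h
    apply h0
    rw [← Measure.measure_univ_eq_zero, ← union_compl_self ({0} : Set ℝ)]
    exact measure_union_null hν₁.no_atom_zero h
  · exact (sub_pos.2 (hIntegrand_lt hε hm htt hu)).ne'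

end HFun

/-! ### Jump part of the covariance for Lévy measures on the axes. -/

section Jumps

theorem abs_exp_sub_one_le_exp_abs_sub_one (y : ℝ) : |Real.exp y - 1| ≤ Real.exp |y| - 1 := by
  rcases le_total 0 y with h | h
  · rw [abs_of_nonneg h, abs_of_nonneg (by linarith [Real.add_one_le_exp y])]
  · rw [abs_of_nonpos h, abs_of_nonpos (by linarith [Real.exp_le_one_iff.2 h])]
    have h1 : Real.exp y * Real.exp (-y) = 1 := by
      rw [← Real.exp_add, add_neg_cancel, Real.exp_zero]
    nlinarith [sq_nonneg (Real.exp y - 1), Real.exp_pos (-y), Real.exp_pos y,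
      Real.add_one_le_exp y, Real.add_one_le_exp (-y)]

theorem abs_exp_mul_sub_one_le {r δ u : ℝ} (hr : 0 ≤ r) (hδ : |δ| ≤ |u|) :
    |Real.exp (r * δ) - 1| ≤ |δ| * ((Real.exp (r * |u|) - 1) / |u|) := by
  rcases eq_or_lt_of_le (abs_nonneg u) with h | h
  · have : δ = 0 := by
      rw [← h] at hδ
      exact abs_nonpos_iff.1 hδ
    simp [this]
  · refine (abs_exp_sub_one_le_exp_abs_sub_one _).trans ?_
    rw [abs_mul, abs_of_nonneg hr]
    have hθ : |δ| / |u| ≤ 1 := by rwa [div_le_one h]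
    -- Chord of `exp` over `[0, r|u|]`, evaluated at `r|δ|`.
    have h1 := convexOn_exp.2 (mem_univ 0) (mem_univ (r * |u|)) (sub_nonneg.2 hθ)
      (div_nonneg (abs_nonneg δ) h.le) (sub_add_cancel 1 _)
    simp only [smul_eq_mul, mul_zero, zero_add, Real.exp_zero, mul_one] at h1
    have h2 : |δ| / |u| * (r * |u|) = r * |δ| := by field_simp
    rw [h2] at h1
    have h3 : |δ| * ((Real.exp (r * |u|) - 1) / |u|) =
        |δ| / |u| * Real.exp (r * |u|) - |δ| / |u| := by ring
    rw [h3]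
    linarith

/-- The increments `a` and `δ` are taken at two different points, so `|a_k δ_k| ≤ (a_k² + δ_k²)/2`
reduces the product to two sums of squares with the same bound `S`. -/
theorem sum_mul_exp_sub_le {ι : Type*} [Fintype ι] {a δ : ι → ℝ} {r u w S : ℝ} (hr : 0 ≤ r)
    (hδ : ∀ k, |δ k| ≤ |u|) (ha2 : ∑ k, a k ^ 2 ≤ S) (hδ2 : ∑ k, δ k ^ 2 ≤ S) :
    ∑ k, a k * (Real.exp (r * (w + δ k)) - Real.exp (r * w)) ≤
      Real.exp (r * w) * (S * ((Real.exp (r * |u|) - 1) / |u|)) := by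
  have hE : 0 ≤ (Real.exp (r * |u|) - 1) / |u| := by
    have : 1 ≤ Real.exp (r * |u|) := Real.one_le_exp (by positivity)
    exact div_nonneg (by linarith) (abs_nonneg u)
  have h1 : ∀ k, a k * (Real.exp (r * (w + δ k)) - Real.exp (r * w)) ≤
      Real.exp (r * w) * ((a k ^ 2 + δ k ^ 2) / 2 * ((Real.exp (r * |u|) - 1) / |u|)) := fun k => by
    have h2 : a k * (Real.exp (r * (w + δ k)) - Real.exp (r * w)) =
        Real.exp (r * w) * (a k * (Real.exp (r * δ k) - 1)) := by
      rw [mul_add, Real.exp_add]; ring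
    rw [h2]
    refine mul_le_mul_of_nonneg_left ?_ (Real.exp_pos _).le
    refine (le_abs_self _).trans ?_
    rw [abs_mul]
    refine (mul_le_mul_of_nonneg_left (abs_exp_mul_sub_one_le hr (hδ k)) (abs_nonneg _)).trans ?_
    rw [← mul_assoc]
    refine mul_le_mul_of_nonneg_right ?_ hE
    nlinarith [sq_nonneg (|a k| - |δ k|), sq_abs (a k), sq_abs (δ k)]
  refine (Finset.sum_le_sum fun k _ => h1 k).trans ?_
  rw [← Finset.mul_sum, ← Finset.sum_mul, ← Finset.sum_div, Finset.sum_add_distrib]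
  gcongr
  linarith

variable {d : ℕ} {p ε m : ℝ} {ν₁ : Measure ℝ}

theorem continuous_euclideanSingle (k : Fin d) :
    Continuous fun u : ℝ => (EuclideanSpace.single k u : EuclideanSpace ℝ (Fin d)) := by
  refine (PiLp.continuous_toLp 2 _).comp (continuous_pi fun j => ?_)
  by_cases h : j = k
  · subst h
    simp only [Pi.single_eq_same]
    exact continuous_id
  · simpa [Pi.single_eq_of_ne h] using continuous_const

theorem restrict_map_single (k : Fin d) (n : ℕ) :
    (ν₁.map (fun u : ℝ => (EuclideanSpace.single k u : EuclideanSpace ℝ (Fin d)))).restrict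
      (jumpsAbove _ n) = (ν₁.restrict (jumpsAbove ℝ n)).map
        (fun u : ℝ => EuclideanSpace.single k u) := by
  rw [Measure.restrict_map (continuous_euclideanSingle k).measurable (measurableSet_jumpsAbove n)]
  congr 2
  ext u
  simp [jumpsAbove]

/-- Bound on the jump part of the covariance for functions with controlled increments along
the axes. -/
theorem setIntegral_jumps_le (hε : 0 < ε) (hm : 0 < m)
    (hν₁ : IsLevyMeasure ν₁) {r : ℝ} (hr : 0 ≤ r) (hi : Integrable (hIntegrand d p ε m r) ν₁)
    (g : EuclideanSpace ℝ (Fin d) →ᵇ ℝ)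
    (hL : ∀ x k u, |g (x + EuclideanSpace.single k u) - g x| ≤ |u|)
    (hS : ∀ x u, ∑ k, (g (x + EuclideanSpace.single k u) - g x) ^ 2 ≤
      p ^ 2 * |u| ^ 2 * (1 + |u| * (d : ℝ) ^ (1 / (2 * p - 2)) / (ε * m)) ^ (2 * p - 2))
    (n : ℕ) (y z : EuclideanSpace ℝ (Fin d)) :
    ∫ u in jumpsAbove _ n, (g (y + u) - g y) * (Real.exp (r * g (z + u)) - Real.exp (r * g z))
      ∂(∑ k : Fin d, ν₁.map (fun u : ℝ => EuclideanSpace.single k u)) ≤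
      hFun d p ε m ν₁ r * Real.exp (r * g z) := by
  have hfin := hν₁.isFiniteMeasure_restrict n
  have hres : (∑ k : Fin d, ν₁.map (fun u : ℝ => EuclideanSpace.single k u)).restrict
      (jumpsAbove (EuclideanSpace ℝ (Fin d)) n) = ∑ k : Fin d, (ν₁.restrict (jumpsAbove ℝ n)).map
        (fun u : ℝ => EuclideanSpace.single k u) := by
    rw [← Measure.restrictₗ_apply, map_sum]
    exact Finset.sum_congr rfl fun k _ => by rw [Measure.restrictₗ_apply, restrict_map_single]
  let Φ : EuclideanSpace ℝ (Fin d) →ᵇ ℝ :=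
    (pullbackOp ⟨fun u => y + u, by fun_prop⟩ g - BoundedContinuousFunction.const _ (g y)) *
      (pullbackOp ⟨fun u => z + u, by fun_prop⟩ (expMulFun r g) -
        BoundedContinuousFunction.const _ (Real.exp (r * g z)))
  have hΦ : ∀ u, Φ u = (g (y + u) - g y) * (Real.exp (r * g (z + u)) - Real.exp (r * g z)) :=
    fun u => rfl
  simp only [← hΦ]
  rw [hres, integral_finsetSum_measure (fun k _ => Φ.integrable _)]
  have hint : ∀ k ∈ Finset.univ, Integrable (fun u : ℝ => Φ (EuclideanSpace.single k u))
      (ν₁.restrict (jumpsAbove ℝ n)) := fun k _ =>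
    (pullbackOp ⟨_, continuous_euclideanSingle k⟩ Φ).integrable _
  have hmap : ∀ k : Fin d, ∫ u, Φ u ∂((ν₁.restrict (jumpsAbove ℝ n)).map
        (fun u : ℝ => EuclideanSpace.single k u)) =
      ∫ u, Φ (EuclideanSpace.single k u) ∂(ν₁.restrict (jumpsAbove ℝ n)) := fun k =>
    integral_map (continuous_euclideanSingle k).measurable.aemeasurable
      Φ.continuous.aestronglyMeasurable
  simp only [hmap]
  rw [← integral_finsetSum _ hint]
  have hpt : ∀ u : ℝ, ∑ k, Φ (EuclideanSpace.single k u) ≤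
      Real.exp (r * g z) * (p ^ 2 * hIntegrand d p ε m r u) := fun u => by
    have h := sum_mul_exp_sub_le (a := fun k => g (y + EuclideanSpace.single k u) - g y)
      (δ := fun k => g (z + EuclideanSpace.single k u) - g z) (w := g z) hr
      (fun k => hL z k u) (hS y u) (hS z u)
    simp only [add_sub_cancel] at h
    simp only [hΦ]
    refine h.trans_eq ?_
    congr 1
    unfold hIntegrand
    -- The quotient by `|u|` combines with the factor `|u|²` of `S`; at `u = 0` both sides vanish.
    rcases eq_or_ne |u| 0 with h0 | h0
    · simp [h0]
    · field_simp
  refine (integral_mono (integrable_finsetSum _ hint)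
    (((hi.restrict (s := jumpsAbove ℝ n)).const_mul _).const_mul _) hpt).trans ?_
  rw [integral_const_mul, integral_const_mul, mul_comm, hFun]
  have h := setIntegral_le_integral (s := jumpsAbove ℝ n) hi
    (Filter.Eventually.of_forall fun u => hIntegrand_nonneg hε hm hr u)
  gcongr

end Jumps

/-! ### Tail bounds by truncation and Chernoff's inequality. -/

section Tails

variable {E : Type*} [NormedAddCommGroup E] [MeasurableSpace E] [BorelSpace E]

/-- The truncation `min f K` of a nonnegative continuous function. -/
noncomputable def truncFun (f : E → ℝ) (hf : Continuous f) (hf0 : ∀ x, 0 ≤ f x) (K : ℕ) :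
    E →ᵇ ℝ :=
  BoundedContinuousFunction.ofNormedAddCommGroup (fun x => min (f x) K)
    (by fun_prop) K (fun x => by
      rw [Real.norm_of_nonneg (le_min (hf0 x) (Nat.cast_nonneg K))]
      exact min_le_right _ _)

@[simp]
theorem truncFun_apply (f : E → ℝ) (hf : Continuous f) (hf0 : ∀ x, 0 ≤ f x) (K : ℕ) (x : E) :
    truncFun f hf hf0 K x = min (f x) K := rfl

theorem tendsto_integral_truncFun {μ : Measure E} {f : E → ℝ} (hf : Continuous f)
    (hf0 : ∀ x, 0 ≤ f x) (hi : Integrable f μ) :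
    Filter.Tendsto (fun K => ∫ x, truncFun f hf hf0 K x ∂μ) Filter.atTop (𝓝 (∫ x, f x ∂μ)) := by
  refine tendsto_integral_of_dominated_convergence f
    (fun K => (hf.min continuous_const).aestronglyMeasurable) hi
    (fun K => Filter.Eventually.of_forall fun x => ?_)
    (Filter.Eventually.of_forall fun x => ?_)
  · rw [truncFun_apply, Real.norm_of_nonneg (le_min (hf0 x) (Nat.cast_nonneg K))]
    exact min_le_left _ _
  · refine tendsto_const_nhds.congr' ?_
    filter_upwards [Filter.eventually_ge_atTop ⌈f x⌉₊] with K hK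
    rw [truncFun_apply, min_eq_left ((Nat.le_ceil _).trans (Nat.cast_le.2 hK))]

theorem measureReal_ge_le_of_laplace_le {μ : Measure E} [IsProbabilityMeasure μ] {g : E →ᵇ ℝ}
    {t L : ℝ} (ht : 0 ≤ t)
    (h : ∫ x, Real.exp (t * g x) ∂μ ≤ Real.exp (t * ∫ x, g x ∂μ + L)) (x : ℝ) :
    μ.real {ω | ∫ x, g x ∂μ + x ≤ g ω} ≤ Real.exp (-(t * x - L)) := by
  have h1 := measure_ge_le_exp_mul_mgf (μ := μ) (X := g) (∫ x, g x ∂μ + x) ht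
    ((expMulFun t g).integrable μ)
  refine h1.trans ((mul_le_mul_of_nonneg_left h (Real.exp_pos _).le).trans_eq ?_)
  rw [← Real.exp_add]
  congr 1
  ring

theorem tails_of_laplace_truncFun_le {μ : Measure E} [IsProbabilityMeasure μ] {f : E → ℝ}
    (hf : Continuous f) (hf0 : ∀ x, 0 ≤ f x) (hi : Integrable f μ) {t L : ℝ} (ht : 0 ≤ t)
    (hup : ∀ K, ∫ x, Real.exp (t * truncFun f hf hf0 K x) ∂μ ≤
      Real.exp (t * ∫ x, truncFun f hf hf0 K x ∂μ + L))
    (hlow : ∀ K, ∫ x, Real.exp (t * (-truncFun f hf hf0 K) x) ∂μ ≤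
      Real.exp (t * ∫ x, (-truncFun f hf hf0 K) x ∂μ + L)) (x : ℝ) :
    μ.real {ω | ∫ x, f x ∂μ + x ≤ f ω} ≤ Real.exp (-(t * x - L)) ∧
      μ.real {ω | f ω ≤ ∫ x, f x ∂μ - x} ≤ Real.exp (-(t * x - L)) := by
  have hle : ∀ K, ∫ x, truncFun f hf hf0 K x ∂μ ≤ ∫ x, f x ∂μ := fun K =>
    integral_mono ((truncFun f hf hf0 K).integrable μ) hi fun x => min_le_left _ _
  constructor
  -- For the upper tail one level `K` above the threshold is enough, since truncation only lowers
  -- the mean. For the lower tail this goes the wrong way, and `K → ∞` is needed.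
  · obtain ⟨K, hK⟩ := exists_nat_ge (∫ x, f x ∂μ + x)
    refine le_trans (measureReal_mono fun ω hω => ?_) (measureReal_ge_le_of_laplace_le ht (hup K) x)
    simp only [mem_ofPred_eq, truncFun_apply] at hω ⊢
    have := hle K
    simp only [truncFun_apply] at this
    exact le_min (by linarith) (by linarith)
  · have hlim := (tendsto_integral_truncFun hf hf0 hi).const_sub (∫ x, f x ∂μ)
    rw [sub_self] at hlim
    have hlim2 : Filter.Tendsto (fun K : ℕ => Real.exp (-(t * (x - (∫ x, f x ∂μ -
        ∫ x, truncFun f hf hf0 K x ∂μ)) - L))) Filter.atTop (𝓝 (Real.exp (-(t * (x - 0) - L)))) :=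
      (Real.continuous_exp.tendsto _).comp (((hlim.const_sub x).const_mul t).sub_const L).neg
    rw [sub_zero] at hlim2
    refine ge_of_tendsto' hlim2 fun K => ?_
    refine le_trans (measureReal_mono fun ω hω => ?_)
      (measureReal_ge_le_of_laplace_le ht (hlow K) _)
    have h1 : truncFun f hf hf0 K ω ≤ f ω := min_le_left _ _
    simp only [mem_ofPred_eq, BoundedContinuousFunction.coe_neg, Pi.neg_apply, integral_neg] at hω ⊢
    linarith

end Tails

/-! ### Nondegeneracy of the law. -/

section Nondegenerate

variable {E : Type*} [NormedAddCommGroup E] [InnerProductSpace ℝ E] [FiniteDimensional ℝ E]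
  [MeasurableSpace E] [BorelSpace E] [SecondCountableTopology E]

/-- The modulus of the characteristic function is `exp(-∫ (1 - cos⟨t, u⟩) ν(du))`, the drift and the
compensator being imaginary. Modulus one forces the nonnegative integrand to vanish almost
everywhere. -/
theorem IsIDLaw.ae_cos_eq_one_of_dirac {ν : Measure E} {γ : E}
    (h : IsIDLaw (Measure.dirac (0 : E)) γ ν) (t : E) :
    ∀ᵐ u ∂ν, Real.cos (inner ℝ t u) = 1 := by
  have hi := h.levy.integrable_levyKernel t
  have h1 := h.charFun_eq t
  rw [charFun_dirac, inner_zero_left, Complex.ofReal_zero, zero_mul, Complex.exp_zero] at h1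
  have h2 := congrArg norm h1
  rw [Complex.norm_exp, levyExponent_eq, norm_one] at h2
  have h3 := Real.exp_eq_one_iff _ |>.1 h2.symm
  have hre : ∀ u, (levyKernel t u).re = Real.cos (inner ℝ t u) - 1 := fun u => by
    unfold levyKernel
    rw [mul_comm Complex.I, Complex.exp_mul_I]
    split_ifs <;> simp [← Complex.ofReal_cos, ← Complex.ofReal_sin]
  have h4 : ∫ u, (1 - Real.cos (inner ℝ t u)) ∂ν = 0 := by
    have h5 : ∫ u, (levyKernel t u).re ∂ν = (∫ u, levyKernel t u ∂ν).re := integral_re hi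
    have h6 : ∫ u, (1 - Real.cos (inner ℝ t u)) ∂ν = -∫ u, (levyKernel t u).re ∂ν := by
      rw [← integral_neg]
      congr 1
      ext u
      rw [hre]; ring
    rw [h6, h5]
    simpa using h3
  have hint : Integrable (fun u => 1 - Real.cos (inner ℝ t u)) ν := by
    refine hi.re.neg.congr (Filter.Eventually.of_forall fun u => ?_)
    change -(levyKernel t u).re = _
    rw [hre]; ring
  rw [integral_eq_zero_iff_of_nonneg (fun u => sub_nonneg.2 (Real.cos_le_one _)) hint] at h4
  filter_upwards [h4] with u hu
  have : 1 - Real.cos (inner ℝ t u) = 0 := hu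
  linarith

theorem IsIDLaw.levyMeasure_eq_zero_of_dirac {d : ℕ} {ν : Measure (EuclideanSpace ℝ (Fin d))}
    {γ : EuclideanSpace ℝ (Fin d)}
    (h : IsIDLaw (Measure.dirac (0 : EuclideanSpace ℝ (Fin d))) γ ν) : ν = 0 := by
  -- Countably many test vectors `e_k/(j+1)` suffice: for `j ≥ |u_k|` the inner product is less than
  -- `1` in absolute value, where the cosine equals `1` only at `0`.
  have h1 : ∀ᵐ u ∂ν, ∀ (k : Fin d) (j : ℕ),
      Real.cos (inner ℝ (EuclideanSpace.single k (1 / ((j : ℝ) + 1))) u) = 1 :=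
    ae_all_iff.2 fun k => ae_all_iff.2 fun j => h.ae_cos_eq_one_of_dirac _
  have h2 : ∀ᵐ u ∂ν, u = 0 := by
    filter_upwards [h1] with u hu
    ext k
    obtain ⟨j, hj⟩ := exists_nat_ge |u k|
    have h3 := hu k j
    have hj1 : (0 : ℝ) < (j : ℝ) + 1 := by positivity
    rw [EuclideanSpace.inner_single_left] at h3
    have h4 : |1 / ((j : ℝ) + 1) * u k| < 1 := by
      rw [abs_mul, abs_of_pos (by positivity), one_div_mul_eq_div, div_lt_one hj1]
      linarith
    have h5 := abs_lt.1 h4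
    have hpi := Real.pi_gt_three
    simp only [conj_trivial] at h3
    rw [Real.cos_eq_one_iff_of_lt_of_lt (by linarith) (by linarith)] at h3
    simpa [hj1.ne'] using h3
  rw [← Measure.measure_univ_eq_zero, ← union_compl_self ({0} : Set (EuclideanSpace ℝ (Fin d)))]
  exact measure_union_null h.levy.no_atom_zero h2

end Nondegenerate

/-! ### Deviation inequalities for the norm. -/

theorem mem_icoZero_expMomentSup {Ω : Type*} [MeasurableSpace Ω] {P : Measure Ω} {Y : Ω → ℝ}
    {t : ℝ} (ht : t ∈ icoZero (expMomentSup P Y)) :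
    ∃ s, t < s ∧ Integrable (fun ω => Real.exp (s * |Y ω|)) P := by
  obtain ⟨_, ⟨s, hs, rfl⟩, hts⟩ := lt_sSup_iff.1 ht.2
  exact ⟨s, (ENNReal.ofReal_lt_ofReal_iff hs.1).1 hts, hs.2⟩

theorem integrableOn_exp_levyMeasure_axis {d : ℕ} {μ : Measure (EuclideanSpace ℝ (Fin d))}
    [IsProbabilityMeasure μ] {γ : EuclideanSpace ℝ (Fin d)} {ν₁ : Measure ℝ}
    (h : IsIDLaw μ γ (∑ k : Fin d, ν₁.map (fun u : ℝ => EuclideanSpace.single k u)))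
    (k : Fin d) {s : ℝ} (hs : 0 ≤ s) (hint : Integrable (fun x => Real.exp (s * |x k|)) μ) :
    IntegrableOn (fun u => Real.exp (s * |u|)) (jumpsAbove ℝ 0) ν₁ := by
  have h1 := h.integrableOn_exp (q := fun x => |x k|) (by fun_prop) (fun u v => by
    have h2 := abs_add_le ((u + v) k) (-(v k))
    have h3 : |v k| ≤ ‖v‖ := PiLp.norm_apply_le v k
    rw [abs_neg] at h2
    simp only [PiLp.add_apply, add_neg_cancel_right] at h2 ⊢
    linarith) hs hint
  have h2 : ν₁.map (fun u : ℝ => (EuclideanSpace.single k u : EuclideanSpace ℝ (Fin d))) ≤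
      ∑ k : Fin d, ν₁.map (fun u : ℝ => EuclideanSpace.single k u) :=
    Finset.single_le_sum (f := fun k : Fin d => ν₁.map
      (fun u : ℝ => (EuclideanSpace.single k u : EuclideanSpace ℝ (Fin d))))
      (fun _ _ => Measure.zero_le _) (Finset.mem_univ k)
  have h3 := h1.mono_measure h2
  rw [IntegrableOn, restrict_map_single, integrable_map_measure (by fun_prop)
    (continuous_euclideanSingle k).measurable.aemeasurable] at h3
  simpa [Function.comp_def, IntegrableOn] using h3

/-- Deviation bounds for the `ℓ^p` norm at a fixed parameter of the Laplace transform. -/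
theorem ellNorm_tails {d : ℕ} {μ : Measure (EuclideanSpace ℝ (Fin d))}
    [IsProbabilityMeasure μ] {γ : EuclideanSpace ℝ (Fin d)} {ν₁ : Measure ℝ}
    (h : IsIDLaw μ γ (∑ k : Fin d, ν₁.map (fun u : ℝ => EuclideanSpace.single k u)))
    (hν₁ : IsLevyMeasure ν₁) {p ε m : ℝ} (hp : 2 ≤ p) (hε : 0 < ε) (hm0 : 0 < m)
    (hi : Integrable (ellNorm p) μ) (hm : m = ∫ x, ellNorm p x ∂μ) {t : ℝ} (ht : 0 ≤ t)
    (hint : ∀ r ∈ Icc 0 t, Integrable (hIntegrand d p ε m r) ν₁) (x : ℝ) :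
    μ.real {y | (1 + ε) * m + x ≤ ellNorm p y} ≤
        Real.exp (-(t * x - ∫ r in (0 : ℝ)..t, hFun d p ε m ν₁ r)) ∧
      μ.real {y | ellNorm p y ≤ (1 - ε) * m - x} ≤
        Real.exp (-(t * x - ∫ r in (0 : ℝ)..t, hFun d p ε m ν₁ r)) := by
  have hp0 : 0 < p := by linarith
  have hp1 : 1 ≤ p := by linarith
  set b := ε * m with hb
  have hb0 : 0 < b := by positivity
  set f : EuclideanSpace ℝ (Fin d) → ℝ := shiftNorm p b
  have hf : Continuous f := continuous_shiftNorm hp0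
  have hf0 : ∀ y, 0 ≤ f y := fun y => hb0.le.trans (le_shiftNorm hp0 hb0.le y)
  have hfi : Integrable f μ := (hi.add (integrable_const b)).mono' hf.aestronglyMeasurable
    (Filter.Eventually.of_forall fun y => by
      rw [Real.norm_of_nonneg (hf0 y)]
      exact shiftNorm_le_ellNorm_add hp1 hb0.le y)
  -- Since `y ↦ min y K` is 1-Lipschitz, truncation preserves all increment bounds.
  have htrunc : ∀ K x v, |truncFun f hf hf0 K (x + v) - truncFun f hf hf0 K x| ≤
      |f (x + v) - f x| := fun K x v => by
    simpa using abs_min_sub_min_le_max (f (x + v)) K (f x) K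
  have hL : ∀ K x k u, |truncFun f hf hf0 K (x + EuclideanSpace.single k u) -
      truncFun f hf hf0 K x| ≤ |u| := fun K x k u =>
    (htrunc K x _).trans (abs_shiftNorm_add_single_sub_le hp1 hb0 x k u)
  have hS : ∀ K x u, ∑ k, (truncFun f hf hf0 K (x + EuclideanSpace.single k u) -
      truncFun f hf hf0 K x) ^ 2 ≤
      p ^ 2 * |u| ^ 2 * (1 + |u| * (d : ℝ) ^ (1 / (2 * p - 2)) / b) ^ (2 * p - 2) :=
    fun K x u => (Finset.sum_le_sum fun k _ => sq_le_sq.2 (htrunc K x _)).trans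
      (sum_sq_shiftNorm_sub_le hp hb0 x u)
  have hc : ContinuousOn (hFun d p ε m ν₁) (Icc 0 t) :=
    continuousOn_hFun hε hm0 (hint t (right_mem_Icc.2 ht))
  have htails := tails_of_laplace_truncFun_le hf hf0 hfi ht
    (L := ∫ r in (0 : ℝ)..t, hFun d p ε m ν₁ r)
    (fun K => h.laplace_le _ ht _ hc fun n r hr y z =>
      setIntegral_jumps_le hε hm0 hν₁ hr.1 (hint r hr) _ (hL K) (hS K) n y z)
    (fun K => h.laplace_le _ ht _ hc fun n r hr y z =>
      setIntegral_jumps_le hε hm0 hν₁ hr.1 (hint r hr) _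
        (fun x k u => by
          have h1 := hL K x k u
          rw [abs_sub_comm] at h1
          simpa only [BoundedContinuousFunction.coe_neg, Pi.neg_apply, neg_sub_neg] using h1)
        (fun x u => by
          have h1 := hS K x u
          simpa only [BoundedContinuousFunction.coe_neg, Pi.neg_apply, neg_sub_neg,
            sub_sq_comm (truncFun f hf hf0 K x)] using h1) n y z) x
  -- With `m ≤ E f ≤ m + b` and `‖y‖_p ≤ f(y) ≤ ‖y‖_p + b`, each deviation event of the norm is
  -- contained in one of `f` about its own mean.
  have hm1 : m ≤ ∫ y, f y ∂μ := by
    rw [hm]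
    exact integral_mono hi hfi fun y => ellNorm_le_shiftNorm hp0 hb0.le y
  have hm2 : ∫ y, f y ∂μ ≤ m + b := by
    have h1 := integral_mono hfi (hi.add (integrable_const b))
      fun y => shiftNorm_le_ellNorm_add hp1 hb0.le y
    simp only [Pi.add_apply] at h1
    rw [integral_add hi (integrable_const b), ← hm] at h1
    simpa using h1
  refine ⟨le_trans (measureReal_mono fun y hy => ?_) htails.1,
    le_trans (measureReal_mono fun y hy => ?_) htails.2⟩
  · have h1 : ellNorm p y ≤ f y := ellNorm_le_shiftNorm hp0 hb0.le y
    simp only [mem_ofPred_eq] at hy ⊢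
    linarith
  · have h1 : f y ≤ ellNorm p y + b := shiftNorm_le_ellNorm_add hp1 hb0.le y
    simp only [mem_ofPred_eq] at hy ⊢
    linarith

theorem integral_ellNorm_pos {d : ℕ} {μ ν : Measure (EuclideanSpace ℝ (Fin d))}
    [IsProbabilityMeasure μ] {γ : EuclideanSpace ℝ (Fin d)} (h : IsIDLaw μ γ ν) (hν : ν ≠ 0)
    {p : ℝ} (hp : 1 ≤ p) (hi : Integrable (ellNorm p) μ) : 0 < ∫ x, ellNorm p x ∂μ := by
  have hp0 : 0 < p := by linarith
  refine lt_of_le_of_ne (integral_nonneg (ellNorm_nonneg hp0)) fun h0 => hν ?_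
  rw [eq_comm, integral_eq_zero_iff_of_nonneg (ellNorm_nonneg hp0) hi] at h0
  have h1 : ∀ᵐ x ∂μ, x = 0 := by
    filter_upwards [h0] with x hx
    ext k
    have h2 := (abs_apply_le_shiftNorm hp0 le_rfl x k).trans
      (shiftNorm_le_ellNorm_add hp le_rfl x)
    rw [hx] at h2
    simpa using h2
  have h2 : μ = Measure.dirac 0 := by
    ext s hs
    rw [Measure.dirac_apply' _ hs]
    by_cases hs0 : (0 : EuclideanSpace ℝ (Fin d)) ∈ s
    · rw [indicator_of_mem hs0, Pi.one_apply, ← mem_ae_iff_prob_eq_one hs]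
      filter_upwards [h1] with x hx
      rwa [hx]
    · rw [indicator_of_notMem hs0, measure_eq_zero_iff_ae_notMem]
      filter_upwards [h1] with x hx
      rwa [hx]
  rw [h2] at h
  exact h.levyMeasure_eq_zero_of_dirac

theorem corollary5 {Ω : Type*} [MeasurableSpace Ω] (P : Measure Ω) [IsProbabilityMeasure P]
    {d : ℕ} [NeZero d] (X : Ω → EuclideanSpace ℝ (Fin d)) (hX : Measurable X)
    -- the law of `X` is `ID(γ, 0, ν)` with `ν ≠ 0`
    (γ : EuclideanSpace ℝ (Fin d)) (ν : Measure (EuclideanSpace ℝ (Fin d)))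
    (hν : ν ≠ 0) (hID : IsIDLaw (P.map X) γ ν)
    -- the coordinates of `X` are i.i.d.
    (hindep : iIndepFun (fun (k : Fin d) (ω : Ω) => X ω k) P)
    (hident : ∀ k : Fin d, IdentDistrib (fun ω => X ω k) (fun ω => X ω 0) P P)
    -- `ν` consists of copies on the axes of the one-dimensional Lévy measure `ν₁`
    (ν₁ : Measure ℝ) (hν₁ : IsLevyMeasure ν₁)
    (haxes : ν = ∑ k : Fin d, ν₁.map (fun u : ℝ => EuclideanSpace.single k u))
    -- exponential moments
    (hexp : ∃ t : ℝ, 0 < t ∧ Integrable (fun ω => Real.exp (t * ‖X ω‖)) P)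
    (p ε : ℝ) (hp : 2 ≤ p) (hε : 0 < ε)
    -- notation: `m = E ‖X‖_p`, the bound `M`, the function `h` and its inverse on `[0, M)`
    (m : ℝ) (hm : m = ∫ ω, ellNorm p (X ω) ∂P)
    (M : ENNReal) (hM : M = expMomentSup P (fun ω => X ω 0))
    (h : ℝ → ℝ) (hh : h = hFun d p ε m ν₁)
    (hinv : ℝ → ℝ) (hhinv : hinv = Function.invFunOn h (icoZero M)) :
    -- all objects are well defined: `E ‖X‖_p` is finite and positive, `h` is finite on `[0, M)`
    -- and an increasing bijection from `[0, M)` onto `[0, h(M^-))`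
    Integrable (fun ω => ellNorm p (X ω)) P ∧ 0 < m ∧ 0 < M ∧
    (∀ t ∈ icoZero M, Integrable (hIntegrand d p ε m t) ν₁) ∧
    StrictMonoOn h (icoZero M) ∧ h '' icoZero M = icoZero (limAtEnd h M) ∧
    -- the deviation inequalities
    ∀ x : ℝ, 0 < x → ENNReal.ofReal x < limAtEnd h M →
      IntervalIntegrable hinv volume 0 x ∧
      P.real {ω | (1 + ε) * m + x ≤ ellNorm p (X ω)} ≤ Real.exp (-∫ s in (0 : ℝ)..x, hinv s) ∧
      P.real {ω | ellNorm p (X ω) ≤ (1 - ε) * m - x} ≤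
        Real.exp (-∫ s in (0 : ℝ)..x, hinv s) := by
  have hp0 : 0 < p := by linarith
  have hp1 : 1 ≤ p := by linarith
  subst haxes
  have hμ : IsProbabilityMeasure (P.map X) := Measure.isProbabilityMeasure_map hX.aemeasurable
  have hint : Integrable (fun ω => ellNorm p (X ω)) P := by
    obtain ⟨t, ht, hti⟩ := hexp
    refine (hti.const_mul (1 / t)).mono'
      ((continuous_ellNorm hp0).measurable.comp hX).aestronglyMeasurable
      (Filter.Eventually.of_forall fun ω => ?_)
    rw [Real.norm_of_nonneg (ellNorm_nonneg hp0 _), one_div_mul_eq_div, le_div_iff₀ ht]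
    have h1 := ellNorm_le_norm hp (X ω)
    have h2 := Real.add_one_le_exp (t * ‖X ω‖)
    nlinarith
  have hintμ : Integrable (ellNorm p) (P.map X) :=
    (integrable_map_measure (continuous_ellNorm hp0).aestronglyMeasurable hX.aemeasurable).2 hint
  have hmμ : m = ∫ x, ellNorm p x ∂(P.map X) := by
    rw [hm, integral_map hX.aemeasurable (continuous_ellNorm hp0).aestronglyMeasurable]
  have hm0 : 0 < m := by
    rw [hmμ]
    exact integral_ellNorm_pos hID hν hp1 hintμ
  have hν₁0 : ν₁ ≠ 0 := by
    rintro rfl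
    exact hν (by simp)
  have hM0 : 0 < M := by
    obtain ⟨t, ht, hti⟩ := hexp
    rw [hM]
    refine lt_of_lt_of_le (ENNReal.ofReal_pos.2 ht) (le_sSup (mem_image_of_mem _ ⟨ht, ?_⟩))
    have hX0 : Measurable fun ω => X ω 0 := by fun_prop
    refine hti.mono' (by fun_prop) (Filter.Eventually.of_forall fun ω => ?_)
    rw [Real.norm_of_nonneg (Real.exp_pos _).le, Real.exp_le_exp]
    exact mul_le_mul_of_nonneg_left (PiLp.norm_apply_le (X ω) 0) ht.le
  have hhint : ∀ t ∈ icoZero M, Integrable (hIntegrand d p ε m t) ν₁ := by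
    intro t ht
    rw [hM] at ht
    obtain ⟨s, hts, hs⟩ := mem_icoZero_expMomentSup ht
    refine integrable_hIntegrand hp hε hm0 hν₁ ht.1 hts
      (integrableOn_exp_levyMeasure_axis hID 0 (ht.1.trans hts.le) ?_)
    exact (integrable_map_measure (by fun_prop) hX.aemeasurable).2 hs
  have hmono : StrictMonoOn h (icoZero M) := by
    intro t ht t' ht' htt
    rw [hh]
    exact hFun_lt hp hε hm0 hν₁ hν₁0 htt (hhint t ht) (hhint t' ht')
  have hcont : ∀ t ∈ icoZero M, ContinuousOn h (Icc 0 t) := fun t ht => by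
    rw [hh]
    exact continuousOn_hFun hε hm0 (hhint t ht)
  have h0 : h 0 = 0 := by rw [hh]; exact hFun_zero
  have himage := image_icoZero hM0 h0 hmono hcont
  refine ⟨hint, hm0, hM0, hhint, hmono, himage, fun x hx hxM => ?_⟩
  -- `T = h⁻¹(x)` is the critical point of `t ↦ t x - ∫_0^t h`, hence the optimal Chernoff
  -- parameter.
  obtain ⟨T, hT, hTx⟩ : x ∈ h '' icoZero M := by
    rw [himage]
    exact ⟨hx.le, hxM⟩
  have hsub := Icc_subset_icoZero hT
  have hleft : ∀ r ∈ Icc 0 T, hinv (h r) = r := fun r hr => by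
    rw [hhinv]
    exact hmono.injOn.leftInvOn_invFunOn (hsub hr)
  obtain ⟨hii, hval⟩ := integral_inverse_of_strictMonoOn hT.1 (hcont T hT) (hmono.mono hsub) h0 hTx
    hleft
  obtain ⟨h1, h2⟩ := ellNorm_tails hID hν₁ hp hε hm0 hintμ hmμ hT.1
    (fun r hr => hhint r (hsub hr)) x
  have hmeas := (continuous_ellNorm (d := d) hp0).measurable
  rw [map_measureReal_apply hX (measurableSet_le measurable_const hmeas)] at h1
  rw [map_measureReal_apply hX (measurableSet_le hmeas measurable_const)] at h2
  rw [hval, hh]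
  exact ⟨hii, h1, h2⟩
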